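/- Let $X$ be a proper $\mathrm{CAT}(0)$-space with visual boundary $\partial X$, and let $\mathrm{Iso}(X)$ be its isometry group, equipped with the compact-open topology. For a subgroup $G<\mathrm{Iso}(X)$ let $\Lambda\subset\partial X$ be its limit set, that is, the set of accumulation points in $\partial X$ of an orbit of $G$ on $X$, where $X\cup\partial X$ carries the cone topology. Call $G$ non-elementary if $\Lambda$ contains at least three points and $G$ does not globally fix a point of $\partial X$. Call an isometry $g$ of $X$ rank-one if its displacement function $x\mapsto d(x,gx)$ assumes a positive minimum and if for some $B>0$ there is an axis $\gamma:\mathbb{R}\to X$ of $g$ (a geodesic line which $g$ translates by this minimum) which is $B$-contracting: for every closed metric ball $K\subset X$ disjoint from $\gamma(\mathbb{R})$, the shortest distance projection of $K$ to $\gamma(\mathbb{R})$ has diameter at most $B$. Let $G<\mathrm{Iso}(X)$ be a closed non-elementary subgroup with limit set $\Lambda$, and let $g\in G$ be a rank-one element with fixed points $a\neq b\in\Lambda$. If $G$ does not act transitively on the complement of the diagonal in $\Lambda\times\Lambda$, then there is some $h\in G$ such that the stabilizer in $G$ of the pair $(b,hb)\in\Lambda\times\Lambda$ is compact. -/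

import Mathlib

open Set Metric Topology
open scoped NNReal

namespace RankOne

universe u

/-- `γ` restricted to `J ⊆ ℝ` is a geodesic parametrised by arc length. -/
def IsGeodesicOn {X : Type u} [MetricSpace X] (γ : ℝ → X) (J : Set ℝ) : Prop :=
  ∀ s ∈ J, ∀ t ∈ J, dist (γ s) (γ t) = |s - t|

/-- A `CAT(0)` space: any two points are joined by a geodesic, and geodesic triangles are not
thicker than their comparison triangles `p, q, r` in the Euclidean plane. The triangle has the
vertices `α 0 = β 0`, `α a`, `β b` and the sides `α`, `β` (and any geodesic from `α a` to `β b`).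
As every vertex may play the role of `α 0`, all pairs of points on two sides are compared. -/
structure IsCAT0 (X : Type u) [MetricSpace X] : Prop where
  exists_geodesic : ∀ x y : X, ∃ γ : ℝ → X,
    IsGeodesicOn γ (Icc 0 (dist x y)) ∧ γ 0 = x ∧ γ (dist x y) = y
  comparison : ∀ (α β : ℝ → X) (a b : ℝ), 0 ≤ a → 0 ≤ b →
    IsGeodesicOn α (Icc 0 a) → IsGeodesicOn β (Icc 0 b) → α 0 = β 0 →
    ∀ p q r : EuclideanSpace ℝ (Fin 2),
      dist p q = a → dist p r = b → dist q r = dist (α a) (β b) →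
      ∀ s ∈ Icc (0 : ℝ) 1, ∀ t ∈ Icc (0 : ℝ) 1,
        dist (α (s * a)) (β (t * b)) ≤ dist (AffineMap.lineMap p q s) (AffineMap.lineMap p r t)

/-! ### The visual boundary -/

/-- Geodesic rays `[0, ∞) → X`. -/
structure Ray (X : Type u) [MetricSpace X] where
  toFun : ℝ≥0 → X
  isometry' : Isometry toFun

/-- Two rays are asymptotic if they stay at bounded distance from each other. -/
instance raySetoid (X : Type u) [MetricSpace X] : Setoid (Ray X) where
  r c c' := ∃ C : ℝ, ∀ t, dist (c.toFun t) (c'.toFun t) ≤ C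
  iseqv :=
    { refl := fun c => ⟨0, fun t => by simp⟩
      symm := fun ⟨C, h⟩ => ⟨C, fun t => by rw [dist_comm]; exact h t⟩
      trans := fun ⟨C, h⟩ ⟨D, k⟩ =>
        ⟨C + D, fun t => (dist_triangle _ _ _).trans (add_le_add (h t) (k t))⟩ }

/-- The visual boundary `∂X`: asymptoty classes of geodesic rays. -/
def Boundary (X : Type u) [MetricSpace X] : Type u := Quotient (raySetoid X)

/-- The endpoint `c(∞) ∈ ∂X` of a ray. -/
def Ray.endpoint {X : Type u} [MetricSpace X] (c : Ray X) : Boundary X :=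
  Quotient.mk (raySetoid X) c

/-- The image of a ray under an isometry. -/
def Ray.map {X : Type u} [MetricSpace X] (g : X ≃ᵢ X) (c : Ray X) : Ray X :=
  ⟨fun t => g (c.toFun t), g.isometry.comp c.isometry'⟩

/-- The action of the isometry group on the boundary, `g • c(∞) = (g ∘ c)(∞)`. -/
instance boundaryMulAction (X : Type u) [MetricSpace X] : MulAction (X ≃ᵢ X) (Boundary X) where
  smul g := Quotient.map (Ray.map g) (fun _ _ ⟨C, h⟩ =>
    ⟨C, fun t => by simpa [Ray.map, g.isometry.dist_eq] using h t⟩)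
  one_smul ξ := by
    induction ξ using Quotient.inductionOn
    rfl
  mul_smul g h ξ := by
    induction ξ using Quotient.inductionOn
    rfl

/-- The space `X ∪ ∂X`. -/
inductive Bordification (X : Type u) [MetricSpace X] : Type u
  | inner (x : X) : Bordification X
  | ideal (ξ : Boundary X) : Bordification X

/-- The set of all `z ∈ X ∪ ∂X` at distance more than `r` from `c(0)` for which the geodesic from
`c(0)` to `z` is at the time `r` at distance less than `ε` from `c(r)`. -/
def coneNhd {X : Type u} [MetricSpace X] (c : Ray X) (r : ℝ≥0) (ε : ℝ) : Set (Bordification X) :=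
  {z | (∃ x p : X, z = .inner x ∧ (r : ℝ) < dist (c.toFun 0) x ∧ dist (c.toFun 0) p = r ∧
          dist p x = dist (c.toFun 0) x - r ∧ dist p (c.toFun r) < ε) ∨
       (∃ c' : Ray X, z = .ideal c'.endpoint ∧ c'.toFun 0 = c.toFun 0 ∧
          dist (c'.toFun r) (c.toFun r) < ε)}

/-- The cone topology on `X ∪ ∂X`: it is generated by the open balls of `X` and the sets
`coneNhd c r ε`. -/
instance coneTopology (X : Type u) [MetricSpace X] : TopologicalSpace (Bordification X) :=
  TopologicalSpace.generateFrom
    ({U | ∃ (x : X) (r : ℝ), U = Bordification.inner '' ball x r} ∪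
     {U | ∃ (c : Ray X) (r : ℝ≥0) (ε : ℝ), 0 < r ∧ 0 < ε ∧ U = coneNhd c r ε})

/-! ### Groups of isometries -/

/-- The compact-open topology on the isometry group. -/
instance isoTopology (X : Type u) [MetricSpace X] : TopologicalSpace (X ≃ᵢ X) :=
  TopologicalSpace.induced (fun g => (⟨g, g.continuous⟩ : C(X, X))) inferInstance

/-- The limit set of `G`: the accumulation points in `∂X` of an orbit of `G` in `X`. -/
def limitSet {X : Type u} [MetricSpace X] (G : Subgroup (X ≃ᵢ X)) : Set (Boundary X) :=
  {ξ | ∃ x : X, AccPt (Bordification.ideal ξ)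
    (Filter.principal {z | ∃ g ∈ G, z = Bordification.inner (g x)})}

/-- `G` is non-elementary: its limit set has at least three points and `G` has no global fixed
point in `∂X`. -/
def IsNonelementary {X : Type u} [MetricSpace X] (G : Subgroup (X ≃ᵢ X)) : Prop :=
  3 ≤ (limitSet G).encard ∧ ¬ ∃ ξ : Boundary X, ∀ g ∈ G, g • ξ = ξ

/-! ### Rank-one isometries -/

/-- `p` is a point of `L` of smallest distance to `x`. -/
def IsProjection {X : Type u} [MetricSpace X] (L : Set X) (x p : X) : Prop :=
  p ∈ L ∧ ∀ q ∈ L, dist x p ≤ dist x q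

/-- The shortest distance projection to `L` of every closed ball disjoint from `L` has diameter at
most `B`. -/
def IsContracting {X : Type u} [MetricSpace X] (B : ℝ) (L : Set X) : Prop :=
  ∀ (x : X) (r : ℝ), Disjoint (closedBall x r) L →
    ∀ y ∈ closedBall x r, ∀ z ∈ closedBall x r, ∀ p q : X,
      IsProjection L y p → IsProjection L z q → dist p q ≤ B

/-- An isometry is axial if its displacement function assumes a minimum and this minimum is
positive. -/
def IsAxial {X : Type u} [MetricSpace X] (g : X ≃ᵢ X) : Prop :=
  ∃ τ : ℝ, IsLeast (range fun x => dist x (g x)) τ ∧ 0 < τ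

/-- The geodesic line `γ` is an oriented axis of `g`: the isometry `g` acts on it as the
translation by the minimum `τ` of the displacement function, and `τ` is positive. -/
def IsAxis {X : Type u} [MetricSpace X] (g : X ≃ᵢ X) (γ : ℝ → X) : Prop :=
  Isometry γ ∧ ∃ τ : ℝ, IsLeast (range fun x => dist x (g x)) τ ∧ 0 < τ ∧
    ∀ t, g (γ t) = γ (t + τ)

/-- A rank-one isometry: an axial isometry with an axis that is `B`-contracting for a `B > 0`. -/
def IsRankOne {X : Type u} [MetricSpace X] (g : X ≃ᵢ X) : Prop :=
  IsAxial g ∧ ∃ B : ℝ, 0 < B ∧ ∃ γ : ℝ → X, IsAxis g γ ∧ IsContracting B (range γ)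

end RankOne

/-
Suppose that no stabilizer of a pair `(b, h b)` is compact. If `h b ≠ b`, the contraction of the
axis of `g` yields a geodesic line `ρ` from `h b` to `b`. An isometry fixing both ends of `ρ`
moves `ρ` by a translation up to a bounded error, and by properness the stabilizer of `(b, h b)`
contains elements `u` with arbitrarily large translation. Moving the axis forward by a power of
`g` and back by `u⁻¹` shifts it to a bounded neighbourhood of `ρ`. As `G` is closed, these
isometries subconverge to a `φ ∈ G` with `φ b = b` and `φ a = h b`, where `a` is the other end of
the axis. Hence `G` acts transitively on the pairs of distinct points of the orbit `G b`, which
contains `a`.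

It remains to see that `G b` contains every limit point `ξ`. Contraction shows that for any two
translates of the axis, some end of the first and some end of the second are joined by a line
passing near both base points. By transitivity this line may be taken to be a translate of the
axis. So translates of the axis pass near a fixed point and then near the members of an orbit
sequence which converges to `ξ`. They subconverge to a translate of the axis ending at `ξ`.
-/

namespace RankOne

open MulAction Filter

variable {X : Type*} [MetricSpace X]

/-! ### Geodesics -/

section Geodesic

variable {γ : ℝ → X} {J K : Set ℝ}

theorem IsGeodesicOn.dist_of_le (h : IsGeodesicOn γ J) {s t : ℝ} (hs : s ∈ J) (ht : t ∈ J)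
    (hst : s ≤ t) : dist (γ s) (γ t) = t - s := by
  rw [h s hs t ht, abs_sub_comm, abs_of_nonneg (sub_nonneg.2 hst)]

theorem IsGeodesicOn.of_dist_eq_sub
    (h : ∀ s ∈ J, ∀ t ∈ J, s ≤ t → dist (γ s) (γ t) = t - s) : IsGeodesicOn γ J := by
  intro s hs t ht
  rcases le_total s t with hst | hts
  · rw [h s hs t ht hst, abs_sub_comm, abs_of_nonneg (sub_nonneg.2 hst)]
  · rw [dist_comm, h t ht s hs hts, abs_of_nonneg (sub_nonneg.2 hts)]

theorem IsGeodesicOn.of_isometry (h : Isometry γ) (J : Set ℝ) : IsGeodesicOn γ J :=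
  fun s _ t _ => by rw [h.dist_eq, Real.dist_eq]

theorem IsGeodesicOn.mono (h : IsGeodesicOn γ K) (hJ : J ⊆ K) : IsGeodesicOn γ J :=
  fun s hs t ht => h s (hJ hs) t (hJ ht)

theorem IsGeodesicOn.congr {γ' : ℝ → X} (h : IsGeodesicOn γ J) (heq : EqOn γ' γ J) :
    IsGeodesicOn γ' J :=
  fun s hs t ht => by rw [heq hs, heq ht, h s hs t ht]

theorem IsGeodesicOn.comp_add (h : IsGeodesicOn γ K) (c : ℝ) (hJ : MapsTo (c + ·) J K) :
    IsGeodesicOn (fun t => γ (c + t)) J :=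
  fun s hs t ht => by rw [h _ (hJ hs) _ (hJ ht), add_sub_add_left_eq_sub]

theorem IsGeodesicOn.comp_sub (h : IsGeodesicOn γ K) (c : ℝ) (hJ : MapsTo (c - ·) J K) :
    IsGeodesicOn (fun t => γ (c - t)) J :=
  fun s hs t ht => by rw [h _ (hJ hs) _ (hJ ht), sub_sub_sub_cancel_left, abs_sub_comm]

theorem IsGeodesicOn.continuousOn (h : IsGeodesicOn γ J) : ContinuousOn γ J :=
  LipschitzOnWith.continuousOn (K := 1) <| .of_dist_le_mul fun s hs t ht => by
    rw [h s hs t ht, NNReal.coe_one, one_mul, Real.dist_eq]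

theorem IsGeodesicOn.trans {a b c : ℝ} (hab : IsGeodesicOn γ (Icc a b))
    (hbc : IsGeodesicOn γ (Icc b c)) (hle : a ≤ b) (hle' : b ≤ c)
    (hac : dist (γ a) (γ c) = c - a) : IsGeodesicOn γ (Icc a c) := by
  refine .of_dist_eq_sub fun s hs t ht hst => ?_
  rcases le_total t b with htb | hbt
  · exact hab.dist_of_le ⟨hs.1, hst.trans htb⟩ ⟨ht.1, htb⟩ hst
  rcases le_total b s with hbs | hsb
  · exact hbc.dist_of_le ⟨hbs, hs.2⟩ ⟨hbs.trans hst, ht.2⟩ hst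
  have has := hab.dist_of_le ⟨le_rfl, hle⟩ ⟨hs.1, hsb⟩ hs.1
  have hsb' := hab.dist_of_le ⟨hs.1, hsb⟩ ⟨hle, le_rfl⟩ hsb
  have hbt' := hbc.dist_of_le ⟨le_rfl, hle'⟩ ⟨hbt, ht.2⟩ hbt
  have htc := hbc.dist_of_le ⟨hbt, ht.2⟩ ⟨hle', le_rfl⟩ ht.2
  have upper := dist_triangle (γ s) (γ b) (γ t)
  have lower := dist_triangle4 (γ a) (γ s) (γ t) (γ c)
  linarith

theorem isometry_comp_neg (h : Isometry γ) : Isometry fun t => γ (-t) :=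
  .of_dist_eq fun s t => by rw [h.dist_eq, dist_neg_neg]

end Geodesic

/-! ### Busemann convexity -/

/-- A Busemann convex space: any two points are joined by a geodesic, and two geodesics which issue
from the same point diverge at least linearly, both being parametrised proportionally to `[0, 1]`.
This is the form in which the `CAT(0)` inequality enters the argument. -/
structure IsBusemannConvex (X : Type*) [MetricSpace X] : Prop where
  exists_geodesic : ∀ x y : X, ∃ γ : ℝ → X,
    IsGeodesicOn γ (Icc 0 (dist x y)) ∧ γ 0 = x ∧ γ (dist x y) = y
  dist_le_mul_dist : ∀ (α β : ℝ → X) (a b : ℝ), 0 ≤ a → 0 ≤ b →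
    IsGeodesicOn α (Icc 0 a) → IsGeodesicOn β (Icc 0 b) → α 0 = β 0 →
    ∀ l ∈ Icc (0 : ℝ) 1, dist (α (l * a)) (β (l * b)) ≤ l * dist (α a) (β b)

theorem exists_dist_eq_of_triangle_inequalities {a b c : ℝ} (ha : 0 ≤ a) (hb : 0 ≤ b)
    (hc : 0 ≤ c) (hcab : c ≤ a + b) (habc : a ≤ b + c) (hbac : b ≤ a + c) :
    ∃ p q r : EuclideanSpace ℝ (Fin 2), dist p q = a ∧ dist p r = b ∧ dist q r = c := by
  -- The law of cosines: `u = b cos θ` for the angle `θ` at `p`.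
  set u : ℝ := (a ^ 2 + b ^ 2 - c ^ 2) / (2 * a) with hu
  have hua : u * (2 * a) = a ^ 2 + b ^ 2 - c ^ 2 := by
    rcases ha.eq_or_lt with rfl | ha'
    · rw [show c = b by linarith]; simp
    · rw [hu]; field_simp
  have hub : |u| ≤ b := by
    rw [hu, abs_div, abs_of_nonneg (by positivity : 0 ≤ 2 * a)]
    exact div_le_of_le_mul₀ (by positivity) hb (abs_le.2 ⟨by nlinarith, by nlinarith⟩)
  have hv : 0 ≤ b ^ 2 - u ^ 2 := sub_nonneg.2 (sq_le_sq' (abs_le.1 hub).1 (abs_le.1 hub).2)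
  have hqr : (a - u) ^ 2 + (b ^ 2 - u ^ 2) = c ^ 2 := by linarith
  refine ⟨!₂[0, 0], !₂[a, 0], !₂[u, √(b ^ 2 - u ^ 2)], ?_, ?_, ?_⟩
  · simp [EuclideanSpace.dist_eq, Real.dist_eq, Real.sqrt_sq_eq_abs, abs_of_nonneg ha]
  · simp [EuclideanSpace.dist_eq, Real.dist_eq, Real.sq_sqrt hv, Real.sqrt_sq_eq_abs,
      abs_of_nonneg hb]
  · simp [EuclideanSpace.dist_eq, Real.dist_eq, Real.sq_sqrt hv, hqr, Real.sqrt_sq_eq_abs,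
      abs_of_nonneg hc]

theorem IsCAT0.isBusemannConvex (hX : IsCAT0 X) : IsBusemannConvex X where
  exists_geodesic := hX.exists_geodesic
  dist_le_mul_dist α β a b ha hb hα hβ h0 l hl := by
    have hαa : dist (α 0) (α a) = a := by
      rw [hα.dist_of_le ⟨le_rfl, ha⟩ ⟨ha, le_rfl⟩ ha, sub_zero]
    have hβb : dist (α 0) (β b) = b := by
      rw [h0, hβ.dist_of_le ⟨le_rfl, hb⟩ ⟨hb, le_rfl⟩ hb, sub_zero]
    obtain ⟨p, q, r, hpq, hpr, hqr⟩ := exists_dist_eq_of_triangle_inequalities ha hb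
      (dist_nonneg (x := α a) (y := β b))
      (by simpa only [hαa, hβb] using dist_triangle_left (α a) (β b) (α 0))
      (by simpa only [hαa, hβb] using dist_triangle_right (α 0) (α a) (β b))
      (by simpa only [hαa, hβb] using dist_triangle (α 0) (α a) (β b))
    calc dist (α (l * a)) (β (l * b))
        ≤ dist (AffineMap.lineMap p q l) (AffineMap.lineMap p r l) :=
          hX.comparison α β a b ha hb hα hβ h0 p q r hpq hpr hqr l hl l hl
      _ = dist (p + l • (q - p)) (p + l • (r - p)) := by
          simp only [AffineMap.lineMap_apply, vsub_eq_sub, vadd_eq_add, add_comm]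
      _ = l * dist (α a) (β b) := by
          rw [dist_add_left, dist_smul₀, dist_sub_right, Real.norm_of_nonneg hl.1, hqr]

namespace IsBusemannConvex

variable {α β : ℝ → X} {a a' b b' C : ℝ}

theorem dist_convex_combination_le (hX : IsBusemannConvex X) (ha : a ≤ a') (hb : b ≤ b')
    (hα : IsGeodesicOn α (Icc a a')) (hβ : IsGeodesicOn β (Icc b b')) {l : ℝ}
    (hl : l ∈ Icc (0 : ℝ) 1) :
    dist (α (a + l * (a' - a))) (β (b + l * (b' - b))) ≤
      (1 - l) * dist (α a) (β b) + l * dist (α a') (β b') := by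
  obtain ⟨δ, hδ, hδ0, hδ1⟩ := hX.exists_geodesic (α a) (β b')
  set L := dist (α a) (β b')
  have hL : 0 ≤ L := dist_nonneg
  -- Compare both sides with the diagonal `δ` of the quadrilateral.
  have hαδ : dist (α (a + l * (a' - a))) (δ (l * L)) ≤ l * dist (α a') (β b') := by
    simpa [hδ1] using hX.dist_le_mul_dist (fun t => α (a + t)) δ _ _ (sub_nonneg.2 ha) hL
      (hα.comp_add a fun t ht => ⟨by linarith [ht.1], by linarith [ht.2]⟩) hδ (by simp [hδ0]) l hl
  have hδβ : dist (δ (l * L)) (β (b + l * (b' - b))) ≤ (1 - l) * dist (α a) (β b) := by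
    have := hX.dist_le_mul_dist (fun t => δ (L - t)) (fun t => β (b' - t)) _ _ hL
      (sub_nonneg.2 hb) (hδ.comp_sub L fun t ht => ⟨by linarith [ht.2], by linarith [ht.1]⟩)
      (hβ.comp_sub b' fun t ht => ⟨by linarith [ht.2], by linarith [ht.1]⟩) (by simp [hδ1])
      (1 - l) ⟨by linarith [hl.2], by linarith [hl.1]⟩
    rwa [sub_self, sub_sub_cancel, hδ0, show L - (1 - l) * L = l * L by ring,
      show b' - (1 - l) * (b' - b) = b + l * (b' - b) by ring] at this
  linarith [dist_triangle (α (a + l * (a' - a))) (δ (l * L)) (β (b + l * (b' - b)))]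

theorem exists_monotone_dist_le (hX : IsBusemannConvex X) (ha : a ≤ a') (hb : b ≤ b')
    (hα : IsGeodesicOn α (Icc a a')) (hβ : IsGeodesicOn β (Icc b b'))
    (h : dist (α a) (β b) ≤ C) (h' : dist (α a') (β b') ≤ C) :
    ∃ θ : ℝ → ℝ, Monotone θ ∧ MapsTo θ (Icc a a') (Icc b b') ∧
      ∀ t ∈ Icc a a', dist (α t) (β (θ t)) ≤ C := by
  have ha0 := sub_nonneg.2 ha
  have hb0 := sub_nonneg.2 hb
  have hl : ∀ t ∈ Icc a a', (t - a) / (a' - a) ∈ Icc (0 : ℝ) 1 := fun t ht =>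
    ⟨div_nonneg (sub_nonneg.2 ht.1) ha0, div_le_one_of_le₀ (by linarith [ht.2]) ha0⟩
  refine ⟨fun t => b + (t - a) / (a' - a) * (b' - b), fun s t hst => ?_, fun t ht => ?_,
    fun t ht => ?_⟩
  · dsimp only
    gcongr
  · exact ⟨le_add_of_nonneg_right (mul_nonneg (hl t ht).1 hb0),
      by linarith [mul_le_mul_of_nonneg_right (hl t ht).2 hb0]⟩
  · have hconv := hX.dist_convex_combination_le ha hb hα hβ (hl t ht)
    have ht' : a + (t - a) / (a' - a) * (a' - a) = t := by
      rw [div_mul_cancel_of_imp (fun h0 => by linarith [ht.1, ht.2]), add_sub_cancel]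
    rw [ht'] at hconv
    nlinarith [(hl t ht).1, (hl t ht).2]

theorem fellow_travel (hX : IsBusemannConvex X) (hα : IsGeodesicOn α (Icc 0 a))
    (hβ : IsGeodesicOn β (Icc 0 b)) (h0 : dist (α 0) (β 0) ≤ C) (h1 : dist (α a) (β b) ≤ C)
    {t : ℝ} (ht : 0 ≤ t) (hta : t ≤ a) (htb : t ≤ b) : dist (α t) (β t) ≤ 3 * C := by
  obtain ⟨θ, -, hθ, hαβ⟩ :=
    hX.exists_monotone_dist_le (ht.trans hta) (ht.trans htb) hα hβ h0 h1
  have hb0 : (0 : ℝ) ∈ Icc 0 b := ⟨le_rfl, ht.trans htb⟩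
  have hθt := hθ ⟨ht, hta⟩
  have hαt := hα.dist_of_le ⟨le_rfl, ht.trans hta⟩ ⟨ht, hta⟩ ht
  have hβt := hβ.dist_of_le hb0 hθt hθt.1
  have hdrift : dist (β (θ t)) (β t) ≤ 2 * C :=
    calc dist (β (θ t)) (β t)
        = |dist (β 0) (β (θ t)) - dist (α 0) (α t)| := by
          rw [hβ _ hθt _ ⟨ht, htb⟩, hβt, hαt, sub_zero, sub_zero]
      _ ≤ dist (β 0) (α 0) + dist (β (θ t)) (α t) := by
          rw [← Real.dist_eq]
          exact dist_dist_dist_le _ _ _ _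
      _ ≤ 2 * C := by
          rw [dist_comm (β 0), dist_comm (β (θ t))]
          linarith [hαβ t ⟨ht, hta⟩]
  linarith [dist_triangle (α t) (β (θ t)) (β t), hαβ t ⟨ht, hta⟩]

theorem dist_le_dist_zero_of_bounded (hX : IsBusemannConvex X) (hα : IsGeodesicOn α (Ici 0))
    (hβ : IsGeodesicOn β (Ici 0)) (hC : ∀ t, 0 ≤ t → dist (α t) (β t) ≤ C) {t : ℝ} (ht : 0 ≤ t) :
    dist (α t) (β t) ≤ dist (α 0) (β 0) := by
  have hlim : Tendsto (fun s => dist (α 0) (β 0) + t / s * C) atTop (𝓝 (dist (α 0) (β 0))) := by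
    simpa using ((tendsto_id.const_div_atTop t).mul_const C).const_add (dist (α 0) (β 0))
  refine ge_of_tendsto hlim ?_
  filter_upwards [eventually_ge_atTop t, eventually_gt_atTop 0] with s hts hs
  have hl : t / s ∈ Icc (0 : ℝ) 1 := ⟨by positivity, (div_le_one hs).2 hts⟩
  have hconv := hX.dist_convex_combination_le hs.le hs.le (hα.mono fun _ h => h.1)
    (hβ.mono fun _ h => h.1) hl
  rw [zero_add, sub_zero, div_mul_cancel₀ t hs.ne'] at hconv
  refine hconv.trans (add_le_add ?_ (mul_le_mul_of_nonneg_left (hC s hs.le) hl.1))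
  exact mul_le_of_le_one_left dist_nonneg (by linarith [hl.1])

theorem exists_geodesic_through (hX : IsBusemannConvex X) {x p y : X}
    (h : dist x p + dist p y = dist x y) : ∃ δ : ℝ → X,
      IsGeodesicOn δ (Icc 0 (dist x y)) ∧ δ 0 = x ∧ δ (dist x p) = p ∧ δ (dist x y) = y := by
  obtain ⟨α, hα, hα0, hα1⟩ := hX.exists_geodesic x p
  obtain ⟨β, hβ, hβ0, hβ1⟩ := hX.exists_geodesic p y
  set r := dist x p
  have hr : 0 ≤ r := dist_nonneg
  have hry : r ≤ dist x y := by linarith [dist_nonneg (x := p) (y := y)]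
  set δ : ℝ → X := fun t => if t ≤ r then α t else β (t - r)
  have hδα : EqOn δ α (Icc 0 r) := fun t ht => if_pos ht.2
  have hδβ : EqOn δ (fun t => β (-r + t)) (Icc r (dist x y)) := fun t ht => by
    rcases ht.1.eq_or_lt with rfl | hlt
    · simp [δ, hα1, hβ0]
    · simp only [δ, if_neg hlt.not_ge, sub_eq_neg_add]
  have hδ0 : δ 0 = x := (hδα ⟨le_rfl, hr⟩).trans hα0
  have hδy : δ (dist x y) = y :=
    (hδβ ⟨hry, le_rfl⟩).trans (by simp only [← h, neg_add_cancel_left, hβ1])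
  refine ⟨δ, ?_, hδ0, (hδα ⟨hr, le_rfl⟩).trans hα1, hδy⟩
  refine (hα.congr hδα).trans (.congr (hβ.comp_add (-r) ?_) hδβ) hr hry (by rw [hδ0, hδy, sub_zero])
  exact fun t ht => ⟨by linarith [ht.1], by linarith [ht.2]⟩

end IsBusemannConvex

/-! ### Limits of isometries and of geodesics -/

section Limits

variable {ι : Type*} {F : Filter ι} {φ : ι → X ≃ᵢ X} {ψ : X ≃ᵢ X} {x : X} {R : ℝ}

theorem tendsto_isometryEquiv_iff :
    Tendsto φ F (𝓝 ψ) ↔ ∀ x, Tendsto (fun i => φ i x) F (𝓝 (ψ x)) := by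
  have hind : IsInducing (fun g : X ≃ᵢ X => (⟨g, g.continuous⟩ : C(X, X))) := ⟨rfl⟩
  rw [hind.tendsto_nhds_iff]
  refine ⟨fun h x => ((continuous_eval_const (F := C(X, X)) x).tendsto _).comp h, fun h => ?_⟩
  refine ContinuousMap.tendsto_of_tendstoLocallyUniformly ?_
  rw [Metric.tendstoLocallyUniformly_iff]
  intro ε hε x
  refine ⟨ball x (ε / 3), ball_mem_nhds _ (by positivity), ?_⟩
  filter_upwards [Metric.tendsto_nhds.1 (h x) (ε / 3) (by positivity)] with i hi y hy
  have htri := dist_triangle4 (ψ y) (ψ x) (φ i x) (φ i y)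
  rw [ψ.isometry.dist_eq, (φ i).isometry.dist_eq, dist_comm x y, dist_comm (ψ x)] at htri
  rw [mem_ball] at hy
  change dist (ψ y) (φ i y) < ε
  linarith

theorem isGeodesicOn_of_tendsto [F.NeBot] {σ : ι → ℝ → X} {ρ : ℝ → X} {J : Set ℝ}
    (hσ : ∀ s ∈ J, ∀ t ∈ J, ∀ᶠ i in F, dist (σ i s) (σ i t) = |s - t|)
    (hρ : ∀ t ∈ J, Tendsto (fun i => σ i t) F (𝓝 (ρ t))) : IsGeodesicOn ρ J :=
  fun s hs t ht => tendsto_nhds_unique ((hρ s hs).dist (hρ t ht))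
    (tendsto_const_nhds.congr' ((hσ s hs t ht).mono fun _ h => h.symm))

variable [ProperSpace X]

theorem exists_tendsto_of_dist_le (F : Ultrafilter ι) {f : ι → X}
    (h : ∀ᶠ i in (F : Filter ι), dist (f i) x ≤ R) : ∃ y, Tendsto f F (𝓝 y) := by
  obtain ⟨y, -, hy⟩ := (isCompact_closedBall x R).ultrafilter_le_nhds (F.map f)
    (le_principal_iff.2 h)
  exact ⟨y, hy⟩

theorem exists_isometryEquiv_tendsto_of_dist_le (F : Ultrafilter ι)
    (h : ∀ᶠ i in (F : Filter ι), dist (φ i x) x ≤ R) : ∃ ψ : X ≃ᵢ X, Tendsto φ F (𝓝 ψ) := by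
  have hlim : ∀ y, ∃ z, Tendsto (fun i => φ i y) F (𝓝 z) := fun y =>
    exists_tendsto_of_dist_le F (x := x) (R := dist y x + R) <| h.mono fun i hi => by
      have htri := dist_triangle (φ i y) (φ i x) x
      rw [(φ i).isometry.dist_eq] at htri
      linarith
  have hlim_symm : ∀ y, ∃ z, Tendsto (fun i => (φ i).symm y) F (𝓝 z) := fun y =>
    exists_tendsto_of_dist_le F (x := x) (R := dist y x + R) <| h.mono fun i hi => by
      rw [← (φ i).isometry.dist_eq, (φ i).apply_symm_apply]
      linarith [dist_triangle_right y (φ i x) x]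
  choose f hf using hlim
  choose f' hf' using hlim_symm
  have hiso : Isometry f := .of_dist_eq fun y z =>
    tendsto_nhds_unique ((hf y).dist (hf z)) (by simp [(φ _).isometry.dist_eq])
  have hinv : ∀ y, f (f' y) = y := fun y => by
    refine tendsto_nhds_unique (hf (f' y)) ?_
    rw [tendsto_iff_dist_tendsto_zero]
    refine (tendsto_iff_dist_tendsto_zero.1 (hf' y)).congr fun i => ?_
    rw [← (φ i).isometry.dist_eq, (φ i).apply_symm_apply, dist_comm]
  exact ⟨⟨⟨f, f', fun y => hiso.injective (hinv (f y)), hinv⟩, hiso⟩,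
    tendsto_isometryEquiv_iff.2 hf⟩

theorem exists_mem_tendsto_of_dist_le {G : Subgroup (X ≃ᵢ X)}
    (hG : IsClosed (G : Set (X ≃ᵢ X))) (F : Ultrafilter ι) (hφ : ∀ i, φ i ∈ G)
    (h : ∀ᶠ i in (F : Filter ι), dist (φ i x) x ≤ R) : ∃ ψ ∈ G, Tendsto φ F (𝓝 ψ) := by
  obtain ⟨ψ, hψ⟩ := exists_isometryEquiv_tendsto_of_dist_le F h
  exact ⟨ψ, hG.mem_of_tendsto hψ (.of_forall hφ), hψ⟩

theorem exists_isometry_tendsto (F : Ultrafilter ι) {σ : ι → ℝ → X}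
    (hσ : ∀ s t, ∀ᶠ i in (F : Filter ι), dist (σ i s) (σ i t) = |s - t|)
    (h : ∀ᶠ i in (F : Filter ι), dist (σ i 0) x ≤ R) :
    ∃ ρ : ℝ → X, Isometry ρ ∧ ∀ t, Tendsto (fun i => σ i t) F (𝓝 (ρ t)) := by
  have hlim : ∀ t, ∃ y, Tendsto (fun i => σ i t) F (𝓝 y) := fun t =>
    exists_tendsto_of_dist_le F (x := x) (R := |t| + R) <| by
      filter_upwards [hσ t 0, h] with i hi h0
      rw [sub_zero] at hi
      linarith [dist_triangle (σ i t) (σ i 0) x]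
  choose ρ hρ using hlim
  have hgeo : IsGeodesicOn ρ univ := isGeodesicOn_of_tendsto (fun s _ t _ => hσ s t) fun t _ => hρ t
  exact ⟨ρ, .of_dist_eq fun s t => hgeo s trivial t trivial, hρ⟩

end Limits

/-! ### Endpoints of geodesic rays -/

/-- The restriction of `γ` to `[0, ∞)` is a geodesic ray in the class `ξ`. Rays are extended to `ℝ`
by arbitrary values, so that geodesic lines need no separate notion of endpoint. -/
def EndsAt (γ : ℝ → X) (ξ : Boundary X) : Prop :=
  ∃ c : Ray X, (∀ t : ℝ≥0, c.toFun t = γ t) ∧ c.endpoint = ξ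

theorem exists_endsAt (ξ : Boundary X) : ∃ γ : ℝ → X, EndsAt γ ξ := by
  induction ξ using Quotient.inductionOn with
  | h c => exact ⟨fun t => c.toFun t.toNNReal, c, fun t => by simp only [Real.toNNReal_coe], rfl⟩

namespace EndsAt

variable {γ η : ℝ → X} {ξ ζ : Boundary X} {C s : ℝ}

theorem isGeodesicOn (h : EndsAt γ ξ) : IsGeodesicOn γ (Ici 0) := by
  obtain ⟨c, hc, -⟩ := h
  intro s hs t ht
  lift s to ℝ≥0 using hs
  lift t to ℝ≥0 using ht
  rw [← hc, ← hc, c.isometry'.dist_eq, NNReal.dist_eq]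

theorem unique (h : EndsAt γ ξ) (h' : EndsAt γ ζ) : ξ = ζ := by
  obtain ⟨c, hc, rfl⟩ := h
  obtain ⟨c', hc', rfl⟩ := h'
  exact Quotient.sound ⟨0, fun t => by rw [hc, hc', dist_self]⟩

theorem exists_dist_le (h : EndsAt γ ξ) (h' : EndsAt η ξ) :
    ∃ C, ∀ t, 0 ≤ t → dist (γ t) (η t) ≤ C := by
  obtain ⟨c, hc, hξ⟩ := h
  obtain ⟨c', hc', hξ'⟩ := h'
  obtain ⟨C, hC⟩ := Quotient.exact (hξ.trans hξ'.symm)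
  refine ⟨C, fun t ht => ?_⟩
  lift t to ℝ≥0 using ht
  rw [← hc, ← hc']
  exact hC t

theorem of_dist_le (h : EndsAt γ ξ) (hη : IsGeodesicOn η (Ici 0))
    (hC : ∀ᶠ t in atTop, dist (η t) (γ t) ≤ C) : EndsAt η ξ := by
  obtain ⟨T, hT⟩ := eventually_atTop.1 (hC.and (eventually_ge_atTop 0))
  obtain ⟨hTC, hT0⟩ := hT T le_rfl
  have hγ := h.isGeodesicOn
  obtain ⟨c, hc, rfl⟩ := h
  refine ⟨⟨fun t => η t, .of_dist_eq fun s t => hη s s.2 t t.2⟩, fun _ => rfl,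
    Quotient.sound ⟨2 * T + C, fun t => ?_⟩⟩
  have ht := t.coe_nonneg
  change dist (η t) (c.toFun t) ≤ _
  rw [hc]
  rcases le_total T t with hTt | htT
  · linarith [(hT t hTt).1]
  · linarith [dist_triangle4 (η t) (η T) (γ T) (γ t), hη.dist_of_le ht hT0 htT,
      hγ.dist_of_le ht hT0 htT, dist_comm (γ T) (γ t)]

theorem smul (h : EndsAt γ ξ) (g : X ≃ᵢ X) : EndsAt (fun t => g (γ t)) (g • ξ) := by
  obtain ⟨c, hc, rfl⟩ := h
  exact ⟨c.map g, fun t => congrArg g (hc t), rfl⟩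

theorem comp_add (h : EndsAt γ ξ) (hs : IsGeodesicOn γ (Ici s)) :
    EndsAt (fun t => γ (s + t)) ξ := by
  refine h.of_dist_le (C := |s|)
    (hs.comp_add s fun _ ht => le_add_of_nonneg_right (mem_Ici.1 ht)) ?_
  filter_upwards [eventually_ge_atTop 0, eventually_ge_atTop (-s)] with t ht hts
  rw [h.isGeodesicOn _ (neg_le_iff_add_nonneg'.1 hts) _ ht, add_sub_cancel_right]

end EndsAt

namespace IsBusemannConvex

variable {γ η c ρ : ℝ → X} {ξ ζ : Boundary X} {C t : ℝ}

theorem dist_le_dist_zero (hX : IsBusemannConvex X) (hγ : EndsAt γ ξ) (hη : EndsAt η ξ)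
    (ht : 0 ≤ t) : dist (γ t) (η t) ≤ dist (γ 0) (η 0) :=
  have ⟨_, hC⟩ := hγ.exists_dist_le hη
  hX.dist_le_dist_zero_of_bounded hγ.isGeodesicOn hη.isGeodesicOn hC ht

theorem endsAt_of_tendsto (hX : IsBusemannConvex X) {ι : Type*} {F : Filter ι} [F.NeBot]
    {σ : ι → ℝ → X} {l m : ι → ℝ} (hσ : ∀ i, IsGeodesicOn (σ i) (Icc 0 (l i)))
    (hl : Tendsto l F atTop) (hm : Tendsto m F atTop) (hc : EndsAt c ξ)
    (h0 : ∀ᶠ i in F, dist (σ i 0) (c 0) ≤ C) (hend : ∀ᶠ i in F, dist (σ i (l i)) (c (m i)) ≤ C)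
    (hρ : ∀ t, 0 ≤ t → Tendsto (fun i => σ i t) F (𝓝 (ρ t))) : EndsAt ρ ξ := by
  have hgeo : IsGeodesicOn ρ (Ici 0) := isGeodesicOn_of_tendsto (fun s hs t ht => by
    filter_upwards [hl.eventually_ge_atTop s, hl.eventually_ge_atTop t] with i hsi hti
    exact hσ i s ⟨hs, hsi⟩ t ⟨ht, hti⟩) hρ
  refine hc.of_dist_le hgeo (C := 3 * C) ?_
  filter_upwards [eventually_ge_atTop 0] with t ht
  refine le_of_tendsto ((hρ t ht).dist tendsto_const_nhds) ?_
  filter_upwards [h0, hend, hl.eventually_ge_atTop t, hm.eventually_ge_atTop t]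
    with i hi0 hi htl htm
  exact hX.fellow_travel (hσ i) (hc.isGeodesicOn.mono fun _ h => h.1) hi0 hi ht htl htm

theorem endsAt_of_frequently (hX : IsBusemannConvex X) (hc : EndsAt c ξ)
    (hη : IsGeodesicOn η (Ici 0)) (h : ∃ᶠ t in atTop, ∃ s, 0 ≤ s ∧ dist (c t) (η s) ≤ C) :
    EndsAt η ξ := by
  have hc0 := hc.isGeodesicOn
  set D := max C (dist (c 0) (η 0))
  refine hc.of_dist_le hη (C := 3 * D) ?_
  filter_upwards [eventually_ge_atTop 0] with t ht
  -- A point `η s` close to `c t'` for a large `t'` has a large parameter `s`.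
  obtain ⟨t', ⟨s, hs, hts⟩, ht'⟩ :=
    (h.and_eventually (eventually_ge_atTop (t + C + dist (c 0) (η 0)))).exists
  have hC : 0 ≤ C := dist_nonneg.trans hts
  have ht0 : 0 ≤ t' := by linarith [dist_nonneg (x := c 0) (y := η 0)]
  have hst : t ≤ s := by
    have htri := dist_triangle4 (c 0) (η 0) (η s) (c t')
    rw [hc0.dist_of_le self_mem_Ici ht0 ht0, hη.dist_of_le self_mem_Ici hs hs,
      dist_comm (η s)] at htri
    linarith
  rw [dist_comm]
  exact hX.fellow_travel (hc0.mono fun _ h => h.1) (hη.mono fun _ h => h.1) (le_max_right _ _)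
    (hts.trans (le_max_left _ _)) ht (by linarith [dist_nonneg (x := c 0) (y := η 0)]) hst

theorem endsAt_or_endsAt_neg_of_dist_le (hX : IsBusemannConvex X) (hc : EndsAt c ξ)
    (hη : Isometry η) (h : ∀ t, 0 ≤ t → ∃ s, dist (c t) (η s) ≤ C) :
    EndsAt η ξ ∨ EndsAt (fun t => η (-t)) ξ := by
  have hfreq : ∃ᶠ t in atTop, (∃ s, 0 ≤ s ∧ dist (c t) (η s) ≤ C) ∨
      ∃ s, 0 ≤ s ∧ dist (c t) (η (-s)) ≤ C := by
    refine Eventually.frequently ?_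
    filter_upwards [eventually_ge_atTop 0] with t ht
    obtain ⟨s, hs⟩ := h t ht
    rcases le_total 0 s with h0 | h0
    · exact .inl ⟨s, h0, hs⟩
    · exact .inr ⟨-s, neg_nonneg.2 h0, by rwa [neg_neg]⟩
  exact (frequently_or_distrib.1 hfreq).imp (hX.endsAt_of_frequently hc (.of_isometry hη _))
    (hX.endsAt_of_frequently hc (.of_isometry (isometry_comp_neg hη) _))

end IsBusemannConvex

theorem smul_eq_of_tendsto {ι : Type*} {F : Filter ι} [F.NeBot] {φ : ι → X ≃ᵢ X} {ψ : X ≃ᵢ X}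
    (hφ : Tendsto φ F (𝓝 ψ)) {γ η : ℝ → X} {ξ ζ : Boundary X} (hγ : EndsAt γ ξ)
    (hη : EndsAt η ζ) {C : ℝ} (h : ∀ t, 0 ≤ t → ∀ᶠ i in F, dist (φ i (γ t)) (η t) ≤ C) :
    ψ • ξ = ζ := by
  refine (hγ.smul ψ).unique (hη.of_dist_le (C := C) (hγ.smul ψ).isGeodesicOn ?_)
  filter_upwards [eventually_ge_atTop 0] with t ht
  exact le_of_tendsto ((tendsto_isometryEquiv_iff.1 hφ (γ t)).dist tendsto_const_nhds) (h t ht)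

theorem IsBusemannConvex.smul_eq_of_tendsto_of_smul_eq (hX : IsBusemannConvex X) {ι : Type*}
    {F : Filter ι} [F.NeBot] {φ : ι → X ≃ᵢ X} {ψ : X ≃ᵢ X} (hφ : Tendsto φ F (𝓝 ψ))
    {ξ : Boundary X} (h : ∀ᶠ i in F, φ i • ξ = ξ) : ψ • ξ = ξ := by
  obtain ⟨γ, hγ⟩ := exists_endsAt ξ
  refine smul_eq_of_tendsto hφ hγ hγ (C := dist (ψ (γ 0)) (γ 0) + 1) fun t ht => ?_
  have hbdd := ((tendsto_isometryEquiv_iff.1 hφ (γ 0)).dist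
    (tendsto_const_nhds (x := γ 0))).eventually_le_const (lt_add_one _)
  filter_upwards [h, hbdd] with i hi hbddi
  exact (hX.dist_le_dist_zero (hi ▸ hγ.smul (φ i)) hγ ht).trans hbddi

theorem mem_stabilizer_pair_iff {G : Subgroup (X ≃ᵢ X)} {ξ ζ : Boundary X} {u : G} :
    u ∈ stabilizer G (ξ, ζ) ↔ (u : X ≃ᵢ X) • ξ = ξ ∧ (u : X ≃ᵢ X) • ζ = ζ := by
  rw [mem_stabilizer_iff, Prod.smul_mk, Prod.mk.injEq]
  rfl

theorem IsBusemannConvex.isCompact_stabilizer [ProperSpace X] (hX : IsBusemannConvex X)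
    {G : Subgroup (X ≃ᵢ X)} (hG : IsClosed (G : Set (X ≃ᵢ X))) {ξ ζ : Boundary X} {x : X} {R : ℝ}
    (h : ∀ u ∈ G, u • ξ = ξ → u • ζ = ζ → dist (u x) x ≤ R) :
    IsCompact (stabilizer G (ξ, ζ) : Set G) := by
  rw [isCompact_iff_ultrafilter_le_nhds]
  intro F hF
  have hfix : ∀ᶠ u : G in (F : Filter G), (u : X ≃ᵢ X) • ξ = ξ ∧ (u : X ≃ᵢ X) • ζ = ζ :=
    mem_of_superset (le_principal_iff.1 hF) fun _ => mem_stabilizer_pair_iff.1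
  obtain ⟨ψ, hψG, hψ⟩ := exists_mem_tendsto_of_dist_le hG F (φ := fun u : G => (u : X ≃ᵢ X))
    (fun u => u.2) (hfix.mono fun u hu => h u u.2 hu.1 hu.2)
  refine ⟨⟨ψ, hψG⟩, mem_stabilizer_pair_iff.2 ⟨?_, ?_⟩, ?_⟩
  · exact hX.smul_eq_of_tendsto_of_smul_eq hψ (hfix.mono fun _ => And.left)
  · exact hX.smul_eq_of_tendsto_of_smul_eq hψ (hfix.mono fun _ => And.right)
  · rw [nhds_subtype_eq_comap]
    exact tendsto_iff_comap.1 hψ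

/-! ### Contracting sets -/

/-- `π` is a shortest distance projection of `X` to `A`. -/
def IsProjectionMap (A : Set X) (π : X → X) : Prop := ∀ x, IsProjection A x (π x)

namespace IsProjectionMap

variable {A : Set X} {π : X → X} {B : ℝ}

theorem dist_le (hπ : IsProjectionMap A π) (x : X) {y : X} (hy : y ∈ A) :
    dist x (π x) ≤ dist x y := (hπ x).2 y hy

theorem continuous_dist (hπ : IsProjectionMap A π) : Continuous fun x => dist x (π x) :=
  LipschitzWith.continuous (K := 1) <| .of_le_add fun x y => by
    linarith [hπ.dist_le x (hπ y).1, dist_triangle x y (π y)]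

theorem dist_le_of_contracting (hπ : IsProjectionMap A π) (hA : IsContracting B A) {x y q : X}
    {r : ℝ} (hr : r < dist x (π x)) (hy : dist x y ≤ r) (hq : IsProjection A y q) :
    dist (π x) q ≤ B := by
  have hdisj : Disjoint (closedBall x r) A := Set.disjoint_left.2 fun z hz hzA =>
    (hr.trans_le (hπ.dist_le x hzA)).not_ge (mem_closedBall'.1 hz)
  exact hA x r hdisj x (mem_closedBall_self (dist_nonneg.trans hy)) y (mem_closedBall'.2 hy) _ _
    (hπ x) hq

theorem dist_le_of_dist_le_sub (hπ : IsProjectionMap A π) (hA : IsContracting B A) (hB : 0 < B)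
    {x y : X} (h : dist x y ≤ max (dist x (π x) - B) 0) : dist (π x) (π y) ≤ B := by
  rcases le_max_iff.1 h with h | h
  · exact hπ.dist_le_of_contracting hA (sub_lt_self _ hB) h (hπ y)
  · rw [dist_le_zero.1 h, dist_self]
    exact hB.le

variable {σ : ℝ → X} {s t l : ℝ}

theorem dist_le_of_far (hπ : IsProjectionMap A π) (hA : IsContracting B A) (hB : 0 < B)
    (hst : s ≤ t) (hσ : IsGeodesicOn σ (Icc s t))
    (h : ∀ u ∈ Ico s t, 4 * B < dist (σ u) (π (σ u))) :
    dist (π (σ s)) (π (σ t)) ≤ (t - s) / 4 + B := by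
  rcases hst.eq_or_lt with rfl | hlt
  · simp [hB.le]
  -- Cut `[s, t]` into `N` pieces of length `d ≤ 4 B`; each moves the projection by at most `B`.
  set N := ⌊(t - s) / (4 * B)⌋₊ + 1 with hN
  set d := (t - s) / N with hd
  have hN0 : (0 : ℝ) < N := by positivity
  have hd0 : 0 < d := div_pos (sub_pos.2 hlt) hN0
  have hNd : N * d = t - s := mul_div_cancel₀ _ hN0.ne'
  have hd4 : d ≤ 4 * B := by
    rw [hd, div_le_iff₀ hN0, ← div_le_iff₀' (by positivity), hN]
    exact_mod_cast (Nat.lt_floor_add_one _).le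
  have hstep : ∀ {i : ℕ}, i < N →
      dist (π (σ (s + i * d))) (π (σ (s + (i + 1 : ℕ) * d))) ≤ B := fun {i} hi => by
    have hiN : ((i + 1 : ℕ) : ℝ) * d ≤ t - s :=
      hNd ▸ mul_le_mul_of_nonneg_right (Nat.cast_le.2 hi) hd0.le
    have hi0 : 0 ≤ i * d := by positivity
    push_cast at hiN ⊢
    refine hπ.dist_le_of_contracting hA (h _ ⟨by linarith, by linarith⟩) ?_ (hπ _)
    rw [hσ.dist_of_le ⟨by linarith, by linarith⟩ ⟨by linarith, by linarith⟩ (by linarith)]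
    linarith
  have hfloor : (⌊(t - s) / (4 * B)⌋₊ : ℝ) * B ≤ (t - s) / 4 := by
    refine (mul_le_mul_of_nonneg_right (Nat.floor_le (by positivity)) hB.le).trans (le_of_eq ?_)
    field_simp
  calc dist (π (σ s)) (π (σ t)) ≤ ∑ _i ∈ Finset.range N, B := by
        simpa only [Nat.cast_zero, zero_mul, add_zero, hNd, add_sub_cancel] using
          dist_le_range_sum_of_dist_le (f := fun i : ℕ => π (σ (s + i * d))) N hstep
    _ = ⌊(t - s) / (4 * B)⌋₊ * B + B := by
        rw [Finset.sum_const, Finset.card_range, nsmul_eq_mul, hN, Nat.cast_add_one, add_one_mul]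
    _ ≤ (t - s) / 4 + B := by gcongr

theorem exists_first_dist_le (hπ : IsProjectionMap A π) (hA : IsContracting B A) (hB : 0 < B)
    (hst : s ≤ t) (hσ : IsGeodesicOn σ (Icc s t))
    (h : (t - s) / 4 + B < dist (π (σ s)) (π (σ t))) :
    ∃ r ∈ Icc s t, dist (σ r) (π (σ r)) ≤ 4 * B ∧ dist (π (σ s)) (π (σ r)) ≤ (r - s) / 4 + B ∧
      ∀ u ∈ Icc s t, dist (σ u) (π (σ u)) ≤ 4 * B → r ≤ u := by
  set S : Set ℝ := Icc s t ∩ (fun u => dist (σ u) (π (σ u))) ⁻¹' Iic (4 * B)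
  have hScomp : IsCompact S := isCompact_Icc.of_isClosed_subset
    ((hπ.continuous_dist.comp_continuousOn hσ.continuousOn).preimage_isClosed_of_isClosed
      isClosed_Icc isClosed_Iic) inter_subset_left
  have hSne : S.Nonempty := by
    by_contra! hempty
    exact (hπ.dist_le_of_far hA hB hst hσ fun u hu => not_le.1 fun hle =>
      hempty.le ⟨Ico_subset_Icc_self hu, hle⟩).not_gt h
  obtain ⟨r, ⟨hr, hfr⟩, hleast⟩ := hScomp.exists_isLeast hSne
  refine ⟨r, hr, hfr, ?_, fun u hu hfu => hleast ⟨hu, hfu⟩⟩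
  exact hπ.dist_le_of_far hA hB hr.1 (hσ.mono (Icc_subset_Icc_right hr.2)) fun u hu =>
    not_le.1 fun hle => hu.2.not_ge (hleast ⟨⟨hu.1, hu.2.le.trans hr.2⟩, hle⟩)

theorem exists_dist_le_of_length_le (hπ : IsProjectionMap A π) (hA : IsContracting B A)
    (hB : 0 < B) (hst : s ≤ t) (hσ : IsGeodesicOn σ (Icc s t))
    (h : 3 * B < dist (π (σ s)) (π (σ t)))
    (hlen : t - s ≤ dist (π (σ s)) (π (σ t)) + 4 * B) :
    ∃ s' t', s ≤ s' ∧ s' ≤ t' ∧ t' ≤ t ∧ dist (σ s') (π (σ s)) ≤ 10 * B ∧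
      dist (σ t') (π (σ t)) ≤ 10 * B := by
  obtain ⟨s', hs', hfs', hdrift, hfirst⟩ := hπ.exists_first_dist_le hA hB hst hσ (by linarith)
  obtain ⟨r, hr, hfr, hdrift', -⟩ := hπ.exists_first_dist_le (σ := fun u => σ (0 - u)) hA hB
    (neg_le_neg hst) (hσ.comp_sub 0 fun u hu => ⟨by linarith [hu.2], by linarith [hu.1]⟩)
    (by simp only [zero_sub, neg_neg]; rw [dist_comm]; linarith)
  simp only [zero_sub, neg_neg] at hfr hdrift'
  have hs't' : s' ≤ -r := hfirst _ ⟨by linarith [hr.2], by linarith [hr.1]⟩ hfr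
  have hlength : dist (σ s') (σ (-r)) = -r - s' :=
    hσ.dist_of_le hs' ⟨by linarith [hr.2], by linarith [hr.1]⟩ hs't'
  have hmiddle := dist_triangle4 (π (σ s')) (σ s') (σ (-r)) (π (σ (-r)))
  have htotal := dist_triangle4 (π (σ s)) (π (σ s')) (π (σ (-r))) (π (σ t))
  rw [dist_comm (π (σ s')) (σ s')] at hmiddle
  rw [dist_comm (π (σ (-r))) (π (σ t))] at htotal
  -- The geodesic travels at most `56 / 3 * B` outside of `[s', -r]`.
  refine ⟨s', -r, hs'.1, hs't', by linarith [hr.1], ?_, ?_⟩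
  · have htri := dist_triangle_right (σ s') (π (σ s)) (π (σ s'))
    linarith [hr.1]
  · have htri := dist_triangle_right (σ (-r)) (π (σ t)) (π (σ (-r)))
    linarith [hs'.1]

theorem exists_dist_projection_le (hπ : IsProjectionMap A π) (hA : IsContracting B A)
    (hB : 0 < B) (hl : 0 ≤ l) (hσ : IsGeodesicOn σ (Icc 0 l))
    (h : 2 * B < dist (π (σ 0)) (π (σ l))) :
    ∃ s t, 0 ≤ s ∧ s ≤ t ∧ t ≤ l ∧ dist (π (σ 0)) (π (σ s)) ≤ B ∧
      dist (π (σ l)) (π (σ t)) ≤ B ∧ t - s ≤ dist (π (σ 0)) (π (σ l)) + 2 * B := by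
  -- The balls about the endpoints which just miss `A` contain `σ s` and `σ (l - t)`.
  set s := max (dist (σ 0) (π (σ 0)) - B) 0
  set t := max (dist (σ l) (π (σ l)) - B) 0
  have hs0 : 0 ≤ s := le_max_right _ _
  have ht0 : 0 ≤ t := le_max_right _ _
  have hleft : ∀ u ∈ Icc 0 l, u ≤ s → dist (π (σ 0)) (π (σ u)) ≤ B := fun u hu hus =>
    hπ.dist_le_of_dist_le_sub hA hB (by rwa [hσ.dist_of_le ⟨le_rfl, hl⟩ hu hu.1, sub_zero])
  have hright : ∀ u ∈ Icc 0 l, l - u ≤ t → dist (π (σ l)) (π (σ u)) ≤ B := fun u hu hut =>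
    hπ.dist_le_of_dist_le_sub hA hB (by rwa [dist_comm, hσ.dist_of_le hu ⟨hl, le_rfl⟩ hu.2])
  have hst : s + t < l := by
    by_contra! hle
    have hm : min s l ∈ Icc 0 l := ⟨le_min hs0 hl, min_le_right _ _⟩
    have hmt : l - min s l ≤ t := by
      rw [sub_le_comm]
      exact le_min (by linarith) (by linarith)
    linarith [dist_triangle_right (π (σ 0)) (π (σ l)) (π (σ (min s l))),
      hleft _ hm (min_le_left _ _), hright _ hm hmt]
  refine ⟨s, l - t, hs0, by linarith, by linarith, hleft s ⟨hs0, by linarith⟩ le_rfl,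
    hright _ ⟨by linarith, by linarith⟩ (by linarith), ?_⟩
  have hlen := dist_triangle4 (σ 0) (π (σ 0)) (π (σ l)) (σ l)
  rw [hσ.dist_of_le ⟨le_rfl, hl⟩ ⟨hl, le_rfl⟩ hl, sub_zero, dist_comm _ (σ l)] at hlen
  linarith [le_max_left (dist (σ 0) (π (σ 0)) - B) 0, le_max_left (dist (σ l) (π (σ l)) - B) 0]

theorem exists_dist_le (hπ : IsProjectionMap A π) (hA : IsContracting B A) (hB : 0 < B)
    (hl : 0 ≤ l) (hσ : IsGeodesicOn σ (Icc 0 l)) (h : 5 * B < dist (π (σ 0)) (π (σ l))) :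
    ∃ s t, 0 ≤ s ∧ s ≤ t ∧ t ≤ l ∧ dist (σ s) (π (σ 0)) ≤ 11 * B ∧
      dist (σ t) (π (σ l)) ≤ 11 * B := by
  obtain ⟨s, t, hs, hst, htl, hπs, hπt, hlen⟩ :=
    hπ.exists_dist_projection_le hA hB hl hσ (by linarith)
  have hL := dist_triangle4_right (π (σ 0)) (π (σ l)) (π (σ s)) (π (σ t))
  obtain ⟨s', t', hss', hs't', ht't, hs', ht'⟩ := hπ.exists_dist_le_of_length_le hA hB hst
    (hσ.mono (Icc_subset_Icc hs htl)) (by linarith) (by linarith)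
  refine ⟨s', t', hs.trans hss', hs't', ht't.trans htl, ?_, ?_⟩
  · linarith [dist_triangle_right (σ s') (π (σ 0)) (π (σ s))]
  · linarith [dist_triangle_right (σ t') (π (σ l)) (π (σ t))]

end IsProjectionMap

/-! ### Contracting lines -/

/-- The geodesic line `η` is `B`-contracting, and `η (P x)` is a point of `η` of smallest distance
to `x`. Carrying the parameter `P x` instead of the projection itself orders the projections. -/
structure IsContractingLine (B : ℝ) (η : ℝ → X) (P : X → ℝ) : Prop where
  pos : 0 < B
  isometry : Isometry η
  isProjectionMap : IsProjectionMap (range η) fun x => η (P x)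
  isContracting : IsContracting B (range η)

theorem exists_isContractingLine [ProperSpace X] {B : ℝ} {η : ℝ → X} (hB : 0 < B)
    (hη : Isometry η) (hA : IsContracting B (range η)) : ∃ P, IsContractingLine B η P := by
  have h : ∀ x, ∃ s, IsProjection (range η) x (η s) := fun x => by
    obtain ⟨y, ⟨s, rfl⟩, hy⟩ := hη.isClosedEmbedding.isClosed_range.exists_infDist_eq_dist
      (range_nonempty η) x
    exact ⟨s, mem_range_self s, fun q hq => hy ▸ infDist_le_dist_of_mem hq⟩
  choose P hP using h
  exact ⟨P, hB, hη, hP, hA⟩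

namespace IsContractingLine

variable {B q l d : ℝ} {η σ : ℝ → X} {P : X → ℝ} {ζ : Boundary X}

theorem apply_self (h : IsContractingLine B η P) (s : ℝ) : P (η s) = s :=
  (h.isometry.injective <| dist_le_zero.1 <|
    dist_self (η s) ▸ h.isProjectionMap.dist_le (η s) (mem_range_self s)).symm

theorem neg (h : IsContractingLine B η P) :
    IsContractingLine B (fun t => η (-t)) fun x => -P x := by
  have hrange : range (fun t => η (-t)) = range η := neg_surjective.range_comp η
  exact ⟨h.pos, isometry_comp_neg h.isometry, by simpa [hrange] using h.isProjectionMap,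
    hrange ▸ h.isContracting⟩

theorem map (h : IsContractingLine B η P) (g : X ≃ᵢ X) :
    IsContractingLine B (fun t => g (η t)) fun x => P (g.symm x) := by
  have hsymm : ∀ {x p}, IsProjection (range fun t => g (η t)) x p →
      IsProjection (range η) (g.symm x) (g.symm p) := by
    rintro x _ ⟨⟨s, rfl⟩, hp⟩
    refine ⟨⟨s, (g.symm_apply_apply _).symm⟩, ?_⟩
    rintro _ ⟨t, rfl⟩
    have hle := hp (g (η t)) ⟨t, rfl⟩
    rw [← g.symm.isometry.dist_eq, ← g.symm.isometry.dist_eq x] at hle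
    simpa only [g.symm_apply_apply] using hle
  refine ⟨h.pos, g.isometry.comp h.isometry, fun x => ⟨mem_range_self _, ?_⟩, ?_⟩
  · rintro _ ⟨t, rfl⟩
    have hle := h.isProjectionMap.dist_le (g.symm x) (mem_range_self t)
    rwa [← g.isometry.dist_eq, ← g.isometry.dist_eq (g.symm x), g.apply_symm_apply] at hle
  intro x r hdisj y hy z hz p q hp hq
  rw [← g.symm.isometry.dist_eq]
  refine h.isContracting (g.symm x) r ?_ (g.symm y) ?_ (g.symm z) ?_ _ _ (hsymm hp) (hsymm hq)
  · rw [Set.disjoint_left] at hdisj ⊢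
    rintro _ hw ⟨t, rfl⟩
    refine hdisj (a := g (η t)) ?_ ⟨t, rfl⟩
    rwa [mem_closedBall, ← g.symm.isometry.dist_eq, g.symm_apply_apply]
  · rwa [mem_closedBall, g.symm.isometry.dist_eq]
  · rwa [mem_closedBall, g.symm.isometry.dist_eq]

theorem exists_dist_le (h : IsContractingLine B η P) (hX : IsBusemannConvex X) (hl : 0 ≤ l)
    (hσ : IsGeodesicOn σ (Icc 0 l)) (hP : 5 * B < P (σ l) - P (σ 0)) (hq : P (σ 0) ≤ q)
    (hq' : q ≤ P (σ l)) : ∃ s ∈ Icc 0 l, dist (σ s) (η q) ≤ 11 * B := by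
  have hdist : dist (η (P (σ 0))) (η (P (σ l))) = P (σ l) - P (σ 0) :=
    (IsGeodesicOn.of_isometry h.isometry univ).dist_of_le trivial trivial (hq.trans hq')
  obtain ⟨s, t, hs, hst, htl, hds, hdt⟩ :=
    h.isProjectionMap.exists_dist_le h.isContracting h.pos hl hσ (hdist ▸ hP)
  obtain ⟨θ, -, hθ, hdθ⟩ := hX.exists_monotone_dist_le (hq.trans hq') hst
    (.of_isometry h.isometry _) (hσ.mono (Icc_subset_Icc hs htl)) (dist_comm (σ s) _ ▸ hds)
    (dist_comm (σ t) _ ▸ hdt)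
  have hθq := hθ ⟨hq, hq'⟩
  exact ⟨θ q, ⟨hs.trans hθq.1, hθq.2.trans htl⟩, dist_comm (η q) _ ▸ hdθ q ⟨hq, hq'⟩⟩

theorem exists_eventually_dist_le (h : IsContractingLine B η P) (hX : IsBusemannConvex X)
    (hσ : EndsAt σ ζ) (hη : EndsAt η ζ) : ∃ s, ∀ᶠ t in atTop, dist (σ t) (η (s + t)) ≤ 4 * B := by
  obtain ⟨C, hC⟩ := hσ.exists_dist_le hη
  have hC0 : 0 ≤ C := dist_nonneg.trans (hC 0 le_rfl)
  have hB := h.pos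
  obtain ⟨t₀, ht₀, hclose⟩ : ∃ t, 0 ≤ t ∧ dist (σ t) (η (P (σ t))) ≤ 4 * B := by
    by_contra! hfar
    set t := 4 * C + 4 * B
    have ht0 : 0 ≤ t := by positivity
    have hproj := h.isProjectionMap.dist_le_of_far h.isContracting hB ht0
      (hσ.isGeodesicOn.mono Icc_subset_Ici_self) fun u hu => hfar u hu.1
    have htri := dist_triangle4 (σ 0) (η (P (σ 0))) (η (P (σ t))) (σ t)
    rw [hσ.isGeodesicOn.dist_of_le self_mem_Ici ht0 ht0, dist_comm _ (σ t)] at htri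
    linarith [(h.isProjectionMap.dist_le (σ 0) (mem_range_self 0)).trans (hC 0 le_rfl),
      (h.isProjectionMap.dist_le (σ t) (mem_range_self t)).trans (hC t ht0)]
  have hσ' : EndsAt (fun t => σ (t₀ + t)) ζ :=
    hσ.comp_add (hσ.isGeodesicOn.mono (Ici_subset_Ici.2 ht₀))
  have hη' : EndsAt (fun t => η (P (σ t₀) + t)) ζ := hη.comp_add (.of_isometry h.isometry _)
  refine ⟨P (σ t₀) - t₀, ?_⟩
  filter_upwards [eventually_ge_atTop t₀] with t ht
  have hle := hX.dist_le_dist_zero hσ' hη' (sub_nonneg.2 ht)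
  simp only [add_sub_cancel, add_zero] at hle
  rw [sub_add_eq_add_sub, add_sub_assoc]
  exact hle.trans hclose

theorem dist_le_dist_apply (h : IsContractingLine B η P) {f : X ≃ᵢ X} (hd : B < d)
    (hf : ∀ t, f (η t) = η (t + d)) (x : X) : dist x (η (P x)) ≤ dist x (f x) := by
  by_contra! hlt
  have hproj : IsProjection (range η) (f x) (η (P x + d)) := by
    refine ⟨mem_range_self _, ?_⟩
    rintro _ ⟨s, rfl⟩
    rw [← hf, f.isometry.dist_eq, ← sub_add_cancel s d, ← hf, f.isometry.dist_eq]
    exact h.isProjectionMap.dist_le x (mem_range_self _)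
  have hle := h.isProjectionMap.dist_le_of_contracting h.isContracting hlt le_rfl hproj
  rw [h.isometry.dist_eq, dist_self_add_right] at hle
  exact hd.not_ge ((Real.le_norm_self d).trans hle)

end IsContractingLine

theorem zpow_apply_of_translation {g : X ≃ᵢ X} {γ : ℝ → X} {τ : ℝ}
    (hg : ∀ t, g (γ t) = γ (t + τ)) (k : ℤ) (t : ℝ) : (g ^ k) (γ t) = γ (t + k * τ) := by
  have hg' : ∀ t, g⁻¹ (γ t) = γ (t - τ) := fun t => by
    rw [← sub_add_cancel t τ, ← hg, add_sub_cancel_right]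
    exact g.symm_apply_apply _
  induction k using Int.induction_on generalizing t with
  | zero => simp
  | succ n ih =>
    rw [zpow_add_one, IsometryEquiv.mul_apply, hg, ih, Int.cast_add, Int.cast_one]
    ring_nf
  | pred n ih =>
    rw [zpow_sub_one, IsometryEquiv.mul_apply, hg', ih, Int.cast_sub, Int.cast_one]
    ring_nf

theorem IsContractingLine.endsAt_or_endsAt_neg_of_smul_eq {B τ : ℝ} {γ : ℝ → X}
    {P : X → ℝ} (h : IsContractingLine B γ P) (hX : IsBusemannConvex X) (hτ : 0 < τ) {g : X ≃ᵢ X}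
    (hg : ∀ t, g (γ t) = γ (t + τ)) {ξ : Boundary X} (hξ : g • ξ = ξ) :
    EndsAt γ ξ ∨ EndsAt (fun t => γ (-t)) ξ := by
  obtain ⟨n, hn⟩ := exists_nat_gt (B / τ)
  rw [div_lt_iff₀ hτ] at hn
  have hfix : g ^ (n : ℤ) • ξ = ξ := zpow_mem (K := stabilizer (X ≃ᵢ X) ξ) hξ n
  obtain ⟨c, hc⟩ := exists_endsAt ξ
  refine hX.endsAt_or_endsAt_neg_of_dist_le hc h.isometry
    (C := dist (c 0) ((g ^ (n : ℤ)) (c 0))) fun t ht => ⟨P (c t), ?_⟩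
  calc dist (c t) (γ (P (c t))) ≤ dist (c t) ((g ^ (n : ℤ)) (c t)) :=
        h.dist_le_dist_apply (d := (n : ℤ) * τ) (by exact_mod_cast hn)
          (zpow_apply_of_translation hg n) _
    _ ≤ dist (c 0) ((g ^ (n : ℤ)) (c 0)) :=
        hX.dist_le_dist_zero hc (hfix ▸ hc.smul (g ^ (n : ℤ))) ht

/-! ### Geodesic lines with given endpoints -/

/-- The geodesic line `ρ` runs from the boundary point `ξ` to the boundary point `ζ`. -/
structure Joins (ρ : ℝ → X) (ξ ζ : Boundary X) : Prop where
  isometry : Isometry ρ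
  left : EndsAt (fun t => ρ (-t)) ξ
  right : EndsAt ρ ζ

namespace Joins

variable {ρ : ℝ → X} {ξ ζ : Boundary X}

theorem isGeodesicOn (h : Joins ρ ξ ζ) (J : Set ℝ) : IsGeodesicOn ρ J := .of_isometry h.isometry J

theorem neg (h : Joins ρ ξ ζ) : Joins (fun t => ρ (-t)) ζ ξ :=
  ⟨isometry_comp_neg h.isometry, by simpa only [neg_neg] using h.right, h.left⟩

theorem map (h : Joins ρ ξ ζ) (g : X ≃ᵢ X) : Joins (fun t => g (ρ t)) (g • ξ) (g • ζ) :=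
  ⟨g.isometry.comp h.isometry, h.left.smul g, h.right.smul g⟩

theorem comp_add (h : Joins ρ ξ ζ) (s : ℝ) : Joins (fun t => ρ (s + t)) ξ ζ where
  isometry := h.isometry.comp (isometry_add_left s)
  left := by
    simpa only [neg_add_rev, neg_neg, add_comm] using
      h.left.comp_add (.of_isometry (isometry_comp_neg h.isometry) (Ici (-s)))
  right := h.right.comp_add (.of_isometry h.isometry _)

end Joins

theorem tendsto_length_atTop {ι : Type*} {F : Filter ι} {σ : ι → ℝ → X} {l m : ι → ℝ} {c : ℝ → X}
    {ξ : Boundary X} {x : X} {C : ℝ} (hl0 : ∀ n, 0 ≤ l n)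
    (hσ : ∀ n, IsGeodesicOn (σ n) (Icc 0 (l n))) (hm : Tendsto m F atTop) (hc : EndsAt c ξ)
    (hl : ∀ n, σ n (l n) = c (m n)) (h0 : ∀ n, dist (σ n 0) x ≤ C) : Tendsto l F atTop := by
  refine tendsto_atTop_mono' _ ?_ (tendsto_atTop_add_const_right _ (-(dist (c 0) x + C)) hm)
  filter_upwards [hm.eventually_ge_atTop 0] with n hn
  have htri := dist_triangle4_right (c 0) (c (m n)) x (σ n 0)
  rw [hc.isGeodesicOn.dist_of_le self_mem_Ici hn hn, ← hl, dist_comm (σ n (l n)),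
    (hσ n).dist_of_le ⟨le_rfl, hl0 n⟩ ⟨hl0 n, le_rfl⟩ (hl0 n), dist_comm x] at htri
  linarith [h0 n]

namespace IsBusemannConvex

variable {C : ℝ} {x : X} {c c' : ℝ → X} {ξ ζ : Boundary X} {σ : ℕ → ℝ → X} {u l m : ℕ → ℝ}

theorem exists_joins_of_geodesics [ProperSpace X] (hX : IsBusemannConvex X)
    (hu0 : ∀ n, 0 ≤ u n) (hl0 : ∀ n, 0 ≤ l n) (hσ : ∀ n, IsGeodesicOn (σ n) (Icc (-u n) (l n)))
    (hm : Tendsto m atTop atTop) (hc : EndsAt c ξ) (hc' : EndsAt c' ζ)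
    (hu : ∀ n, σ n (-u n) = c (m n)) (hl : ∀ n, σ n (l n) = c' (m n))
    (h0 : ∀ n, dist (σ n 0) x ≤ C) : ∃ ρ, Joins ρ ξ ζ := by
  have hσl : ∀ n, IsGeodesicOn (σ n) (Icc 0 (l n)) := fun n =>
    (hσ n).mono (Icc_subset_Icc_left (neg_nonpos.2 (hu0 n)))
  have hσu : ∀ n, IsGeodesicOn (fun t => σ n (-t)) (Icc 0 (u n)) := fun n => by
    simpa only [zero_sub] using (hσ n).comp_sub 0 fun t ht =>
      ⟨by linarith [ht.2], by linarith [ht.1, hl0 n]⟩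
  have hl_top : Tendsto l atTop atTop := tendsto_length_atTop hl0 hσl hm hc' hl h0
  have hu_top : Tendsto u atTop atTop := tendsto_length_atTop hu0 hσu hm hc hu (by simpa using h0)
  have hF : (hyperfilter ℕ : Filter ℕ) ≤ atTop := Nat.hyperfilter_le_atTop
  obtain ⟨ρ, hρ, hlim⟩ := exists_isometry_tendsto (hyperfilter ℕ) (σ := σ) (fun s t => by
    have hmem : ∀ s, ∀ᶠ n in atTop, s ∈ Icc (-u n) (l n) := fun s => by
      filter_upwards [hu_top.eventually_ge_atTop (-s), hl_top.eventually_ge_atTop s] with n hn hn'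
      exact ⟨neg_le.1 hn, hn'⟩
    exact hF ((hmem s).and (hmem t) |>.mono fun n hn => hσ n s hn.1 t hn.2)) (.of_forall h0)
  have hbdd : ∀ y, ∀ n, dist (σ n 0) y ≤ C + dist x y := fun y n =>
    (dist_triangle _ x _).trans (by gcongr; exact h0 n)
  have hC : 0 ≤ C := dist_nonneg.trans (h0 0)
  refine ⟨ρ, hρ, ?_, ?_⟩
  · refine hX.endsAt_of_tendsto hσu (hu_top.mono_left hF) (hm.mono_left hF) hc
      (.of_forall fun n => by simpa using hbdd (c 0) n) (.of_forall fun n => ?_)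
      fun t _ => hlim (-t)
    rw [hu, dist_self]
    positivity
  · refine hX.endsAt_of_tendsto hσl (hl_top.mono_left hF) (hm.mono_left hF) hc'
      (.of_forall (hbdd (c' 0))) (.of_forall fun n => ?_) fun t _ => hlim t
    rw [hl, dist_self]
    positivity

end IsBusemannConvex

namespace IsContractingLine

variable {B T n : ℝ} {η c ρ ρ' : ℝ → X} {P : X → ℝ} {ξ ζ : Boundary X} {x : X}

theorem endsAt_of_not_bddAbove (h : IsContractingLine B η P) (hX : IsBusemannConvex X)
    (hc : EndsAt c ξ) (hP : ¬ BddAbove (P ∘ c '' Ici 0)) : EndsAt η ξ := by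
  refine hX.endsAt_of_frequently hc (.of_isometry h.isometry _) (C := 11 * B) ?_
  rw [frequently_atTop]
  intro N
  set D := dist (c 0) (η 0)
  rw [not_bddAbove_iff] at hP
  obtain ⟨_, ⟨t, ht, rfl⟩, htP⟩ := hP (max (P (c 0) + 5 * B) (max (N + D + 11 * B) 0))
  rw [max_lt_iff, max_lt_iff, Function.comp_apply] at htP
  have hB := h.pos
  obtain ⟨s, hs, hd⟩ := h.exists_dist_le hX ht (hc.isGeodesicOn.mono Icc_subset_Ici_self)
    (q := P (c t)) (by linarith) (by linarith) le_rfl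
  refine ⟨s, ?_, P (c t), htP.2.2.le, hd⟩
  have htri := dist_triangle4 (η 0) (c 0) (c s) (η (P (c t)))
  rw [hc.isGeodesicOn.dist_of_le self_mem_Ici hs.1 hs.1, dist_comm _ (c 0), h.isometry.dist_eq,
    Real.dist_eq, zero_sub, abs_neg, abs_of_pos htP.2.2] at htri
  linarith

theorem exists_geodesic_near (h : IsContractingLine B η P) (hX : IsBusemannConvex X)
    (hx : P x ≤ T) (hn : 5 * B < n) : ∃ (σ : ℝ → X) (u l : ℝ), 0 ≤ u ∧ 0 ≤ l ∧
      IsGeodesicOn σ (Icc (-u) l) ∧ σ (-u) = x ∧ σ l = η (T + n) ∧ dist (σ 0) (η T) ≤ 11 * B := by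
  obtain ⟨σ, hσ, hσx, hσn⟩ := hX.exists_geodesic x (η (T + n))
  set L := dist x (η (T + n))
  have hB := h.pos
  obtain ⟨u, hu, hd⟩ := h.exists_dist_le hX dist_nonneg hσ (q := T)
    (by rw [hσx, hσn, h.apply_self]; linarith) (by rwa [hσx])
    (by rw [hσn, h.apply_self]; linarith)
  refine ⟨fun t => σ (u + t), u, L - u, hu.1, sub_nonneg.2 hu.2, hσ.comp_add u fun t ht => ?_, ?_,
    ?_, ?_⟩
  · exact ⟨by linarith [ht.1], by linarith [ht.2]⟩
  · simpa only [add_neg_cancel] using hσx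
  · simpa only [add_sub_cancel] using hσn
  · simpa only [add_zero] using hd

theorem exists_joins [ProperSpace X] (h : IsContractingLine B η P) (hX : IsBusemannConvex X)
    (hζ : EndsAt η ζ) (hne : ξ ≠ ζ) : ∃ ρ, Joins ρ ξ ζ := by
  obtain ⟨c, hc⟩ := exists_endsAt ξ
  obtain ⟨T, hT⟩ : BddAbove (P ∘ c '' Ici 0) := by
    by_contra hP
    exact hne ((h.endsAt_of_not_bddAbove hX hc hP).unique hζ)
  have hB := h.pos
  set m : ℕ → ℝ := fun n => n + (5 * B + 1)
  have hm0 : ∀ n, 0 ≤ m n := fun n => by positivity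
  have hm : Tendsto m atTop atTop := tendsto_atTop_add_const_right _ _ tendsto_natCast_atTop_atTop
  choose σ u l hu0 hl0 hσ hσu hσl hσ0 using fun n => h.exists_geodesic_near hX
    (hT ⟨m n, hm0 n, rfl⟩) (show 5 * B < m n by linarith [n.cast_nonneg (α := ℝ)])
  exact hX.exists_joins_of_geodesics hu0 hl0 hσ hm hc
    (hζ.comp_add (.of_isometry h.isometry (Ici T))) hσu hσl hσ0

theorem exists_add_dist_le (h : IsContractingLine B η P) (hX : IsBusemannConvex X)
    (hζ : EndsAt η ζ) (hρ : Joins ρ ξ ζ) (hρ' : Joins ρ' ξ ζ) :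
    ∃ r, ∀ t, dist (ρ' t) (ρ (r + t)) ≤ 8 * B := by
  obtain ⟨s, hs⟩ := h.exists_eventually_dist_le hX hρ.right hζ
  obtain ⟨s', hs'⟩ := h.exists_eventually_dist_le hX hρ'.right hζ
  set r := s' - s with hr
  refine ⟨r, fun t => ?_⟩
  obtain ⟨T, hT', hT, htT⟩ := (hs'.and (((tendsto_atTop_add_const_left atTop r
    tendsto_id).eventually hs).and (eventually_ge_atTop t))).exists
  have hρT : dist (ρ' T) (ρ (r + T)) ≤ 8 * B := by
    rw [id, ← add_assoc, hr, add_sub_cancel] at hT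
    linarith [dist_triangle_right (ρ' T) (ρ (r + T)) (η (s' + T))]
  have hle := hX.dist_le_dist_zero (hρ'.comp_add T).left (hρ.comp_add (r + T)).left
    (sub_nonneg.2 htT)
  simp only [neg_sub, neg_zero, add_zero, add_assoc, add_sub_cancel] at hle
  exact hle.trans hρT

end IsContractingLine

/-! ### Translations of geodesic lines -/

theorem dist_inv_apply (u : X ≃ᵢ X) (x y : X) : dist (u⁻¹ x) y = dist x (u y) := by
  rw [← u.isometry.dist_eq, ← IsometryEquiv.mul_apply, mul_inv_cancel]
  rfl

/-- Up to an error `C`, the isometry `u` moves the points of the line `ρ` forward by `r`. -/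
def TranslatesWithin (C : ℝ) (u : X ≃ᵢ X) (ρ : ℝ → X) (r : ℝ) : Prop :=
  ∀ t, dist (u (ρ t)) (ρ (r + t)) ≤ C

namespace TranslatesWithin

variable {C r : ℝ} {u : X ≃ᵢ X} {ρ : ℝ → X}

theorem inv (h : TranslatesWithin C u ρ r) : TranslatesWithin C u⁻¹ ρ (-r) := fun t => by
  rw [dist_inv_apply, dist_comm]
  simpa only [add_neg_cancel_left] using h (-r + t)

theorem dist_le (h : TranslatesWithin C u ρ r) (hρ : Isometry ρ) :
    dist (u (ρ 0)) (ρ 0) ≤ C + |r| := by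
  refine (dist_triangle _ (ρ (r + 0)) _).trans (add_le_add (h 0) ?_)
  rw [hρ.dist_eq, add_zero, Real.dist_0_eq_abs]

end TranslatesWithin

namespace IsContractingLine

variable {B : ℝ} {η ρ : ℝ → X} {P : X → ℝ} {ξ ζ : Boundary X}

theorem exists_translatesWithin (h : IsContractingLine B η P) (hX : IsBusemannConvex X)
    (hζ : EndsAt η ζ) (hρ : Joins ρ ξ ζ) {u : X ≃ᵢ X} (hu : u • ξ = ξ) (hu' : u • ζ = ζ) :
    ∃ r, TranslatesWithin (8 * B) u ρ r :=
  h.exists_add_dist_le hX hζ hρ (by simpa only [hu, hu'] using hρ.map u)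

theorem exists_translatesWithin_of_not_isCompact [ProperSpace X] (h : IsContractingLine B η P)
    (hX : IsBusemannConvex X) {G : Subgroup (X ≃ᵢ X)} (hG : IsClosed (G : Set (X ≃ᵢ X)))
    (hζ : EndsAt η ζ) (hρ : Joins ρ ξ ζ) (hnc : ¬ IsCompact (stabilizer G (ζ, ξ) : Set G)) (N : ℝ) :
    ∃ u ∈ G, ∃ r, N ≤ r ∧ TranslatesWithin (8 * B) u ρ r := by
  by_contra! hcon
  refine hnc (hX.isCompact_stabilizer hG (x := ρ 0) (R := 8 * B + N) fun u huG hub hue => ?_)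
  obtain ⟨r, hr⟩ := h.exists_translatesWithin hX hζ hρ hue hub
  have hle : r ≤ N := (lt_of_not_ge fun hN => hcon u huG r hN hr).le
  have hge : -r ≤ N := (lt_of_not_ge fun hN =>
    hcon u⁻¹ (inv_mem huG) (-r) hN hr.inv).le
  exact (hr.dist_le hρ.isometry).trans (by gcongr; exact abs_le'.2 ⟨hle, hge⟩)

end IsContractingLine

/-- The isometry `g` translates the `B`-contracting line `γ` by `τ > 0`. The line runs from `a` to
`b`, and `γ (P x)` is a point of `γ` of smallest distance to `x`. -/
structure IsContractingAxis (g : X ≃ᵢ X) (γ : ℝ → X) (P : X → ℝ) (B τ : ℝ) (a b : Boundary X) : Prop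
    extends IsContractingLine B γ P, Joins γ a b where
  translation_pos : 0 < τ
  apply_eq : ∀ t, g (γ t) = γ (t + τ)

theorem IsGeodesicOn.exists_endsAt {γ : ℝ → X} (h : IsGeodesicOn γ (Ici 0)) :
    ∃ ξ, EndsAt γ ξ :=
  ⟨_, ⟨fun t => γ t, .of_dist_eq fun s t => h s s.2 t t.2⟩, fun _ => rfl, rfl⟩

theorem IsRankOne.exists_isContractingAxis [ProperSpace X] (hX : IsBusemannConvex X) {g : X ≃ᵢ X}
    (hg : IsRankOne g) {b : Boundary X} (hb : g • b = b) :
    ∃ f ∈ Subgroup.zpowers g, ∃ γ P B τ a, IsContractingAxis f γ P B τ a b := by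
  obtain ⟨-, B, hB, γ, ⟨hγ, τ, -, hτ, hgγ⟩, hA⟩ := hg
  obtain ⟨P, h⟩ := exists_isContractingLine hB hγ hA
  rcases h.endsAt_or_endsAt_neg_of_smul_eq hX hτ hgγ hb with hr | hl
  · obtain ⟨a, ha⟩ := (IsGeodesicOn.of_isometry h.neg.isometry _).exists_endsAt
    exact ⟨g, Subgroup.mem_zpowers g, γ, P, B, τ, a, ⟨h, ha, hr, hτ, hgγ⟩⟩
  · obtain ⟨a, ha⟩ := (IsGeodesicOn.of_isometry h.isometry _).exists_endsAt
    refine ⟨g⁻¹, inv_mem (Subgroup.mem_zpowers g), fun t => γ (-t), _, B, τ, a,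
      ⟨h.neg, by simpa only [neg_neg] using ha, hl, hτ, fun t => ?_⟩⟩
    simpa [sub_eq_add_neg, add_comm] using zpow_apply_of_translation hgγ (-1) (-t)

namespace IsContractingAxis

variable {g : X ≃ᵢ X} {γ : ℝ → X} {P : X → ℝ} {B τ : ℝ} {a b e : Boundary X}

theorem exists_zpow (h : IsContractingAxis g γ P B τ a b) (s : ℝ) :
    ∃ k : ℤ, k * τ ≤ s ∧ TranslatesWithin τ (g ^ k) γ s := by
  have hle := Int.floor_le (s / τ)
  have hlt := (Int.lt_floor_add_one (s / τ)).le
  rw [le_div_iff₀ h.translation_pos] at hle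
  rw [div_le_iff₀ h.translation_pos, add_one_mul] at hlt
  refine ⟨⌊s / τ⌋, hle, fun t => ?_⟩
  rw [zpow_apply_of_translation h.apply_eq, add_comm, h.isometry.dist_eq, dist_add_right,
    Real.dist_eq, abs_le]
  constructor <;> linarith [h.translation_pos]

theorem exists_smul_eq_of_not_isCompact [ProperSpace X] (h : IsContractingAxis g γ P B τ a b)
    (hX : IsBusemannConvex X) {G : Subgroup (X ≃ᵢ X)} (hG : IsClosed (G : Set (X ≃ᵢ X)))
    (hg : g ∈ G) (he : e ≠ b) (hnc : ¬ IsCompact (stabilizer G (b, e) : Set G)) :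
    ∃ φ ∈ G, φ • b = b ∧ φ • a = e := by
  obtain ⟨ρ, hρ⟩ := h.exists_joins hX h.right he
  obtain ⟨s, hs⟩ := h.exists_eventually_dist_le hX hρ.right h.right
  choose u huG r hr hu using fun n : ℕ =>
    h.exists_translatesWithin_of_not_isCompact hX hG h.right hρ hnc n
  choose k _ hk using fun n => h.exists_zpow (s + r n)
  have hr_top : Tendsto r atTop atTop := tendsto_atTop_mono hr tendsto_natCast_atTop_atTop
  -- A power of `g` moves `γ v` far out along `γ`, close to `ρ (r n + v)`, and `(u n)⁻¹` pulls this
  -- point back to `ρ v`.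
  have hclose : ∀ v : ℝ, ∀ᶠ n in (hyperfilter ℕ : Filter ℕ),
      dist (((u n)⁻¹ * g ^ k n) (γ v)) (ρ v) ≤ τ + 4 * B + 8 * B := fun v => by
    refine Eventually.filter_mono Nat.hyperfilter_le_atTop ?_
    filter_upwards [(tendsto_atTop_add_const_right _ v hr_top).eventually hs] with n hn
    rw [IsometryEquiv.mul_apply, dist_inv_apply]
    refine (dist_triangle4 _ (γ (s + r n + v)) (ρ (r n + v)) _).trans
      (add_le_add_three (hk n v) ?_ ?_)
    · rwa [dist_comm, add_assoc]
    · rw [dist_comm]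
      exact hu n v
  obtain ⟨φ, hφG, hφ⟩ := exists_mem_tendsto_of_dist_le hG (hyperfilter ℕ)
    (φ := fun n => (u n)⁻¹ * g ^ k n) (fun n => mul_mem (inv_mem (huG n)) (zpow_mem hg _))
    ((hclose 0).mono fun n hn =>
      (dist_triangle _ (ρ 0) (γ 0)).trans (add_le_add_left hn _))
  exact ⟨φ, hφG, smul_eq_of_tendsto hφ h.right hρ.right fun t _ => hclose t,
    smul_eq_of_tendsto hφ h.left hρ.left fun t _ => hclose (-t)⟩

end IsContractingAxis

/-! ### Lines passing near two given lines -/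

/-- The path `γ` comes within distance `R` of `p` at some time in `J` and within distance `R` of `q`
at the same or a later time in `J`. -/
def PassesNear (γ : ℝ → X) (J : Set ℝ) (R : ℝ) (p q : X) : Prop :=
  ∃ u ∈ J, ∃ v ∈ J, u ≤ v ∧ dist (γ u) p ≤ R ∧ dist (γ v) q ≤ R

theorem PassesNear.mono {γ : ℝ → X} {J K : Set ℝ} {R : ℝ} {p q : X} (h : PassesNear γ J R p q)
    (hJ : J ⊆ K) : PassesNear γ K R p q :=
  have ⟨u, hu, v, hv, h⟩ := h
  ⟨u, hJ hu, v, hJ hv, h⟩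

theorem IsBusemannConvex.passesNear_of_dist_le (hX : IsBusemannConvex X) {α β : ℝ → X}
    {a a' b b' C R : ℝ} {p q : X} (ha : a ≤ a') (hb : b ≤ b') (hα : IsGeodesicOn α (Icc a a'))
    (hβ : IsGeodesicOn β (Icc b b')) (h : dist (α a) (β b) ≤ C) (h' : dist (α a') (β b') ≤ C)
    (hpq : PassesNear α (Icc a a') R p q) : PassesNear β (Icc b b') (C + R) p q := by
  obtain ⟨θ, hmono, hθ, hd⟩ := hX.exists_monotone_dist_le ha hb hα hβ h h'
  obtain ⟨u, hu, v, hv, huv, hup, hvq⟩ := hpq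
  exact ⟨θ u, hθ hu, θ v, hθ hv, hmono huv,
    (dist_triangle_left _ _ _).trans (add_le_add (hd u hu) hup),
    (dist_triangle_left _ _ _).trans (add_le_add (hd v hv) hvq)⟩

theorem PassesNear.dist_add_dist_le {γ : ℝ → X} {l R : ℝ} {p q : X}
    (h : PassesNear γ (Icc 0 l) R p q) (hγ : IsGeodesicOn γ (Icc 0 l)) :
    dist (γ 0) p + dist q (γ l) ≤ dist (γ 0) (γ l) + 2 * R := by
  obtain ⟨u, hu, v, hv, huv, hup, hvq⟩ := h
  have hl := hu.1.trans hu.2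
  have hp := dist_triangle (γ 0) (γ u) p
  have hq := dist_triangle_left q (γ l) (γ v)
  rw [hγ.dist_of_le ⟨le_rfl, hl⟩ hu hu.1] at hp
  rw [hγ.dist_of_le hv ⟨hl, le_rfl⟩ hv.2] at hq
  rw [hγ.dist_of_le ⟨le_rfl, hl⟩ ⟨hl, le_rfl⟩ hl]
  linarith

/-- Two contracting lines `η₁`, `η₂` with nearest point parameters `P₁`, `P₂`, oriented such that
`η₂ 0` projects to `η₁` no earlier than `η₁ 0`, and points arbitrarily far back on `η₁` project to
`η₂` no later than `η₂ 0`. Geodesics from far back on `η₁` to far ahead on `η₂` then pass near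
`η₁ 0` and afterwards near `η₂ 0`. -/
structure AreAligned (B : ℝ) (η₁ : ℝ → X) (P₁ : X → ℝ) (η₂ : ℝ → X) (P₂ : X → ℝ) : Prop where
  left : IsContractingLine B η₁ P₁
  right : IsContractingLine B η₂ P₂
  nonneg : 0 ≤ P₁ (η₂ 0)
  frequently_nonpos : ∃ᶠ t in atTop, P₂ (η₁ (-t)) ≤ 0

namespace AreAligned

variable {B t l : ℝ} {η η₁ η₂ σ : ℝ → X} {P P₁ P₂ : X → ℝ} {x y : Boundary X}

theorem passesNear_geodesic (h : AreAligned B η₁ P₁ η₂ P₂) (hX : IsBusemannConvex X)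
    (ht : 5 * B < t) (htP : P₂ (η₁ (-t)) ≤ 0) (hl : 0 ≤ l) (hσ : IsGeodesicOn σ (Icc 0 l))
    (hσ0 : σ 0 = η₁ (-t)) (hσl : σ l = η₂ t) :
    PassesNear σ (Icc 0 l) (22 * B) (η₁ 0) (η₂ 0) := by
  have hB := h.left.pos
  obtain ⟨v, hv, hσv⟩ := h.right.exists_dist_le hX hl hσ (q := 0)
    (by rw [hσ0, hσl, h.right.apply_self]; linarith) (by rwa [hσ0])
    (by rw [hσl, h.right.apply_self]; linarith)
  obtain ⟨δ, hδ, hδ0, hδm⟩ := hX.exists_geodesic (η₁ (-t)) (η₂ 0)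
  have h0 := h.nonneg
  obtain ⟨w, hw, hδw⟩ := h.left.exists_dist_le hX dist_nonneg hδ (q := 0)
    (by rw [hδ0, hδm, h.left.apply_self]; linarith) (by rw [hδ0, h.left.apply_self]; linarith)
    (by rwa [hδm])
  obtain ⟨θ, -, hθ, hδσ⟩ := hX.exists_monotone_dist_le (C := 11 * B) dist_nonneg hv.1 hδ
    (hσ.mono (Icc_subset_Icc_right hv.2)) (by rw [hδ0, hσ0, dist_self]; linarith)
    (by rwa [hδm, dist_comm])
  have hθw := hθ hw
  refine ⟨θ w, ⟨hθw.1, hθw.2.trans hv.2⟩, v, hv, hθw.2, ?_, by linarith⟩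
  linarith [dist_triangle_left (σ (θ w)) (η₁ 0) (δ w), hδσ w hw]

theorem le_dist (h : AreAligned B η₁ P₁ η₂ P₂) (hX : IsBusemannConvex X) (ht : 5 * B < t)
    (htP : P₂ (η₁ (-t)) ≤ 0) : 2 * t ≤ dist (η₁ (-t)) (η₂ t) + 44 * B := by
  obtain ⟨σ, hσ, hσ0, hσl⟩ := hX.exists_geodesic (η₁ (-t)) (η₂ t)
  have hle := (h.passesNear_geodesic hX ht htP dist_nonneg hσ hσ0 hσl).dist_add_dist_le hσ
  rw [hσ0, hσl, h.left.isometry.dist_eq, h.right.isometry.dist_eq, Real.dist_0_eq_abs,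
    Real.dist_eq, zero_sub, abs_neg] at hle
  linarith [le_abs_self t]

theorem ne (h : AreAligned B η₁ P₁ η₂ P₂) (hX : IsBusemannConvex X)
    (hx : EndsAt (fun t => η₁ (-t)) x) (hy : EndsAt η₂ y) : x ≠ y := by
  rintro rfl
  have hB := h.left.pos
  obtain ⟨C, hC⟩ := hx.exists_dist_le hy
  have hC0 := dist_nonneg.trans (hC 0 le_rfl)
  obtain ⟨t, htP, ht⟩ :=
    (h.frequently_nonpos.and_eventually (eventually_gt_atTop (C + 44 * B))).exists
  linarith [h.le_dist hX (by linarith) htP, hC t (by linarith)]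

theorem passesNear_line (h : AreAligned B η₁ P₁ η₂ P₂) (hX : IsBusemannConvex X)
    (hη : IsContractingLine B η P) (hxy : Joins η x y) (hx : EndsAt (fun t => η₁ (-t)) x)
    (hy : EndsAt η₂ y) : PassesNear η univ (26 * B) (η₁ 0) (η₂ 0) := by
  obtain ⟨r₁, hr₁⟩ := hη.neg.exists_eventually_dist_le hX hx hxy.left
  obtain ⟨r₂, hr₂⟩ := hη.exists_eventually_dist_le hX hy hxy.right
  obtain ⟨t, htP, ht₁, ht₂, ht, htr₁, htr₂⟩ := (h.frequently_nonpos.and_eventually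
    (hr₁.and <| hr₂.and <| (eventually_gt_atTop (5 * B)).and <|
      (eventually_ge_atTop (-r₁)).and (eventually_ge_atTop (-r₂)))).exists
  obtain ⟨σ, hσ, hσ0, hσl⟩ := hX.exists_geodesic (η₁ (-t)) (η₂ t)
  have hpass := hX.passesNear_of_dist_le (C := 4 * B) (b := -(r₁ + t)) (b' := r₂ + t)
    dist_nonneg (by linarith) hσ (hxy.isGeodesicOn _) (by rwa [hσ0]) (by rwa [hσl])
    (h.passesNear_geodesic hX ht htP dist_nonneg hσ hσ0 hσl)
  rw [← add_mul] at hpass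
  norm_num at hpass
  exact hpass.mono (subset_univ _)

end AreAligned

namespace IsContractingLine

variable {B : ℝ} {η₁ η₂ : ℝ → X} {P₁ P₂ : X → ℝ} {x x' y y' : Boundary X}

theorem areAligned_or_neg (h₁ : IsContractingLine B η₁ P₁) (h₂ : IsContractingLine B η₂ P₂)
    (h0 : 0 ≤ P₁ (η₂ 0)) :
    AreAligned B η₁ P₁ η₂ P₂ ∨ AreAligned B η₁ P₁ (fun t => η₂ (-t)) fun x => -P₂ x := by
  by_cases hf : ∃ᶠ t in atTop, P₂ (η₁ (-t)) ≤ 0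
  · exact .inl ⟨h₁, h₂, h0, hf⟩
  · refine .inr ⟨h₁, h₂.neg, by rwa [neg_zero], Eventually.frequently ?_⟩
    filter_upwards [not_frequently.1 hf] with t ht
    exact neg_nonpos.2 (not_le.1 ht).le

theorem exists_passesNear_of_joins (h₁ : IsContractingLine B η₁ P₁)
    (h₂ : IsContractingLine B η₂ P₂) (hX : IsBusemannConvex X) (hη₁ : Joins η₁ x x')
    (hη₂ : Joins η₂ y y') : ∃ ξ ∈ ({x, x'} : Set (Boundary X)), ∃ ζ ∈ ({y, y'} : Set (Boundary X)),
      ξ ≠ ζ ∧ ∀ η P, IsContractingLine B η P → Joins η ξ ζ →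
        PassesNear η univ (26 * B) (η₁ 0) (η₂ 0) := by
  wlog h0 : 0 ≤ P₁ (η₂ 0) generalizing η₁ P₁ x x'
  · simpa only [pair_comm x' x, neg_zero] using
      this h₁.neg hη₁.neg (neg_nonneg.2 (le_of_not_ge h0))
  rcases h₁.areAligned_or_neg h₂ h0 with h | h
  · exact ⟨x, .inl rfl, y', .inr rfl, h.ne hX hη₁.left hη₂.right, fun η P hη hxy =>
      h.passesNear_line hX hη hxy hη₁.left hη₂.right⟩
  · refine ⟨x, .inl rfl, y, .inl rfl, h.ne hX hη₁.left hη₂.left, fun η P hη hxy => ?_⟩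
    simpa only [neg_zero] using h.passesNear_line hX hη hxy hη₁.left hη₂.left

end IsContractingLine

/-! ### Limit points -/

namespace IsContractingAxis

variable {g : X ≃ᵢ X} {γ : ℝ → X} {P : X → ℝ} {B τ : ℝ} {a b : Boundary X} {G : Subgroup (X ≃ᵢ X)}

theorem exists_zpow_of_passesNear (h : IsContractingAxis g γ P B τ a b) {ψ : X ≃ᵢ X} {R : ℝ}
    {p q : X} (hψ : PassesNear (fun t => ψ (γ t)) univ R p q) :
    ∃ k : ℤ, dist ((ψ * g ^ k) (γ 0)) p ≤ τ + R ∧ ∃ s, 0 ≤ s ∧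
      dist ((ψ * g ^ k) (γ s)) q ≤ R := by
  obtain ⟨u, -, v, -, huv, hup, hvq⟩ := hψ
  obtain ⟨k, hk, htrans⟩ := h.exists_zpow u
  simp only [IsometryEquiv.mul_apply]
  refine ⟨k, (dist_triangle _ (ψ (γ u)) _).trans (add_le_add ?_ hup), v - k * τ, by linarith, ?_⟩
  · simpa only [ψ.isometry.dist_eq, add_zero] using htrans 0
  · rwa [zpow_apply_of_translation h.apply_eq, sub_add_cancel]

theorem exists_translate_near (h : IsContractingAxis g γ P B τ a b) (hX : IsBusemannConvex X)
    (hg : g ∈ G) (ha : a ∈ orbit G b) (hO : (orbit G b).offDiag ⊆ orbit G (a, b)) {f : X ≃ᵢ X}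
    (hf : f ∈ G) : ∃ ψ ∈ G, dist (ψ (γ 0)) (γ 0) ≤ τ + 26 * B ∧
      ∃ s, 0 ≤ s ∧ dist (ψ (γ s)) (f (γ 0)) ≤ 26 * B := by
  have hγ : IsContractingLine B γ P := h.toIsContractingLine
  have hab : Joins γ a b := h.toJoins
  obtain ⟨ξ, hξ, ζ, hζ, hne, hpass⟩ :=
    hγ.exists_passesNear_of_joins (hγ.map f) hX hab (hab.map f)
  have hξO : ξ ∈ orbit G b := by
    rcases hξ with rfl | rfl
    exacts [ha, mem_orbit_self _]
  have hζO : ζ ∈ orbit G b := by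
    rcases hζ with rfl | rfl
    exacts [mem_orbit_of_mem_orbit (⟨f, hf⟩ : G) ha, mem_orbit b (⟨f, hf⟩ : G)]
  obtain ⟨ψ, hψ⟩ := hO (show (ξ, ζ) ∈ (orbit G b).offDiag from ⟨hξO, hζO, hne⟩)
  obtain ⟨rfl, rfl⟩ := Prod.mk.inj hψ
  obtain ⟨k, hk⟩ := h.exists_zpow_of_passesNear (hpass _ _ (hγ.map ψ) (hab.map ψ))
  exact ⟨_, mul_mem ψ.2 (zpow_mem hg k), hk⟩

end IsContractingAxis

theorem IsBusemannConvex.exists_geodesic_of_mem_limitSet (hX : IsBusemannConvex X)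
    {G : Subgroup (X ≃ᵢ X)} {ξ : Boundary X} (hξ : ξ ∈ limitSet G) :
    ∃ (x : X) (c : ℝ → X), EndsAt c ξ ∧ ∀ r > 0, ∃ f ∈ G, ∃ (δ : ℝ → X) (l : ℝ), r ≤ l ∧
      IsGeodesicOn δ (Icc 0 l) ∧ δ 0 = c 0 ∧ δ l = f x ∧ dist (δ r) (c r) ≤ 1 := by
  obtain ⟨x, hx⟩ := hξ
  obtain ⟨c, c', hc', rfl⟩ := exists_endsAt ξ
  refine ⟨x, c, ⟨c', hc', rfl⟩, fun r hr => ?_⟩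
  lift r to ℝ≥0 using hr.le
  have hopen : IsOpen (coneNhd c' r 1) :=
    TopologicalSpace.isOpen_generateFrom_of_mem (.inr ⟨c', r, 1, hr, one_pos, rfl⟩)
  have hmem : .ideal c'.endpoint ∈ coneNhd c' r 1 := .inr ⟨c', rfl, rfl, by simp⟩
  obtain ⟨_, ⟨hz, f, hf, rfl⟩, -⟩ := accPt_iff_nhds.1 hx _ (hopen.mem_nhds hmem)
  obtain ⟨_, p, hy, hry, hp, hpy, hpc⟩ : ∃ y p, Bordification.inner (f x) = .inner y ∧ _ :=
    hz.resolve_right fun ⟨_, h, _⟩ => nomatch h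
  obtain rfl := Bordification.inner.inj hy
  obtain ⟨δ, hδ, hδ0, hδp, hδy⟩ :=
    hX.exists_geodesic_through (x := c'.toFun 0) (p := p) (y := f x) (by rw [hp, hpy]; ring)
  refine ⟨f, hf, δ, _, hry.le, hδ, hδ0.trans (hc' 0), hδy, ?_⟩
  rw [← hp, hδp, hp, ← hc']
  exact hpc.le

theorem IsGeodesicOn.length_le_of_dist_le {α β : ℝ → X} {a b C : ℝ} (ha : 0 ≤ a) (hb : 0 ≤ b)
    (hα : IsGeodesicOn α (Icc 0 a)) (hβ : IsGeodesicOn β (Icc 0 b)) (h0 : dist (α 0) (β 0) ≤ C)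
    (h1 : dist (α a) (β b) ≤ C) : b ≤ a + 2 * C := by
  have htri := dist_triangle4_left (α 0) (α a) (β 0) (β b)
  rw [hα.dist_of_le ⟨le_rfl, ha⟩ ⟨ha, le_rfl⟩ ha,
    hβ.dist_of_le ⟨le_rfl, hb⟩ ⟨hb, le_rfl⟩ hb] at htri
  linarith

theorem IsBusemannConvex.eventually_dist_le_ray (hX : IsBusemannConvex X) {ι : Type*} {F : Filter ι}
    {α δ : ι → ℝ → X} {c : ℝ → X} {s l m : ι → ℝ} {C D t : ℝ} (hs : ∀ i, 0 ≤ s i)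
    (hα : ∀ i, IsGeodesicOn (α i) (Icc 0 (s i))) (hδ : ∀ i, IsGeodesicOn (δ i) (Icc 0 (l i)))
    (hc : IsGeodesicOn c (Ici 0)) (hm : Tendsto m F atTop) (hml : ∀ i, m i ≤ l i)
    (hαδ : ∀ i, dist (α i 0) (δ i 0) ≤ C) (hαδ' : ∀ i, dist (α i (s i)) (δ i (l i)) ≤ C)
    (hδc : ∀ i, dist (δ i 0) (c 0) ≤ D) (hδc' : ∀ i, dist (δ i (m i)) (c (m i)) ≤ D) (ht : 0 ≤ t) :
    ∀ᶠ i in F, dist (α i t) (c t) ≤ 3 * C + 3 * D := by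
  filter_upwards [hm.eventually_ge_atTop (t + 2 * C)] with i hi
  have hC : 0 ≤ C := dist_nonneg.trans (hαδ i)
  have htm : t ≤ m i := by linarith
  have hts : t ≤ s i := by
    linarith [hml i, (hα i).length_le_of_dist_le (hs i) ((ht.trans htm).trans (hml i)) (hδ i)
      (hαδ i) (hαδ' i)]
  refine (dist_triangle _ (δ i t) _).trans (add_le_add ?_ ?_)
  · exact hX.fellow_travel (hα i) (hδ i) (hαδ i) (hαδ' i) ht hts (htm.trans (hml i))
  · exact hX.fellow_travel ((hδ i).mono (Icc_subset_Icc_right (hml i)))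
      (hc.mono Icc_subset_Ici_self) (hδc i) (hδc' i) ht htm htm

theorem IsContractingAxis.limitSet_subset_orbit [ProperSpace X] {g : X ≃ᵢ X} {γ : ℝ → X}
    {P : X → ℝ} {B τ : ℝ} {a b : Boundary X} {G : Subgroup (X ≃ᵢ X)}
    (h : IsContractingAxis g γ P B τ a b) (hX : IsBusemannConvex X)
    (hG : IsClosed (G : Set (X ≃ᵢ X))) (hg : g ∈ G) (ha : a ∈ orbit G b)
    (hO : (orbit G b).offDiag ⊆ orbit G (a, b)) : limitSet G ⊆ orbit G b := by
  intro ξ hξ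
  obtain ⟨x, c, hc, happrox⟩ := hX.exists_geodesic_of_mem_limitSet hξ
  choose f hfG δ l hl hδ hδ0 hδl hδc using fun n : ℕ => happrox (n + 1) n.cast_add_one_pos
  choose ψ hψG hψ0 s hs hψs using fun n => h.exists_translate_near hX hg ha hO (hfG n)
  have hτ := h.translation_pos
  set C := τ + 26 * B + dist (γ 0) (c 0) + dist (γ 0) x
  have hstart : ∀ n, dist (ψ n (γ 0)) (δ n 0) ≤ C := fun n => by
    rw [hδ0]
    linarith [dist_triangle (ψ n (γ 0)) (γ 0) (c 0), hψ0 n, dist_nonneg (x := γ 0) (y := x)]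
  have hend : ∀ n, dist (ψ n (γ (s n))) (δ n (l n)) ≤ C := fun n => by
    have htri := dist_triangle (ψ n (γ (s n))) (f n (γ 0)) (f n x)
    rw [(f n).isometry.dist_eq] at htri
    rw [hδl]
    linarith [hψs n, dist_nonneg (x := γ 0) (y := c 0)]
  have hm : Tendsto (fun n : ℕ => (n + 1 : ℝ)) (hyperfilter ℕ) atTop :=
    (tendsto_atTop_add_const_right _ 1 tendsto_natCast_atTop_atTop).mono_left
      Nat.hyperfilter_le_atTop
  obtain ⟨φ, hφG, hφ⟩ := exists_mem_tendsto_of_dist_le hG (hyperfilter ℕ) hψG (.of_forall hψ0)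
  refine ⟨⟨φ, hφG⟩, smul_eq_of_tendsto (C := 3 * C + 3 * 1) hφ h.right hc fun t ht => ?_⟩
  exact hX.eventually_dist_le_ray hs
    (fun n => .of_isometry ((ψ n).isometry.comp h.isometry) _) hδ hc.isGeodesicOn hm hl hstart hend
    (fun n => by rw [hδ0, dist_self]; exact zero_le_one) hδc ht

/-! ### Transitivity on pairs of limit points -/

theorem offDiag_orbit_subset {G : Subgroup (X ≃ᵢ X)} {a b : Boundary X}
    (h : ∀ e ∈ orbit G b, e ≠ b → ∃ φ ∈ G, φ • b = b ∧ φ • a = e) :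
    (orbit G b).offDiag ⊆ orbit G (a, b) := by
  rintro ⟨ξ, _⟩ ⟨hξ, ⟨u, rfl⟩, hne⟩
  obtain ⟨φ, hφG, hφb, hφa⟩ := h _ (mem_orbit_of_mem_orbit u⁻¹ hξ) (mt inv_smul_eq_iff.1 hne)
  refine ⟨u * ⟨φ, hφG⟩, Prod.ext ?_ ?_⟩
  · exact (mul_smul u (⟨φ, hφG⟩ : G) a).trans (eq_inv_smul_iff.1 hφa)
  · exact (mul_smul u (⟨φ, hφG⟩ : G) b).trans (congrArg (u • ·) hφb)

end RankOne

open RankOne MulAction in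
theorem mainTheorem10_general {X : Type*} [MetricSpace X] [ProperSpace X]
    (hX : IsBusemannConvex X) (G : Subgroup (X ≃ᵢ X)) (hclosed : IsClosed (G : Set (X ≃ᵢ X)))
    (g : X ≃ᵢ X) (hgG : g ∈ G) (hg : IsRankOne g) (b : Boundary X) (hgb : g • b = b)
    (hGb : ∃ h ∈ G, h • b ≠ b)
    (htrans : ¬ ∀ p ∈ (limitSet G).offDiag, ∀ q ∈ (limitSet G).offDiag, ∃ u ∈ G, u • p = q) :
    ∃ h : G, IsCompact (stabilizer G (b, h • b) : Set G) := by
  obtain ⟨f, hfg, γ, P, B, τ, a, hf⟩ := hg.exists_isContractingAxis hX hgb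
  have hfG : f ∈ G := Subgroup.zpowers_le.2 hgG hfg
  by_contra! hnc
  have hstab : ∀ e ∈ orbit G b, e ≠ b → ∃ φ ∈ G, φ • b = b ∧ φ • a = e := by
    rintro _ ⟨h, rfl⟩ hne
    exact hf.exists_smul_eq_of_not_isCompact hX hclosed hfG hne (hnc h)
  have ha : a ∈ orbit G b := by
    obtain ⟨h, hh, hne⟩ := hGb
    have hhb : h • b ∈ orbit G b := mem_orbit b (⟨h, hh⟩ : G)
    obtain ⟨φ, hφ, -, hφa⟩ := hstab _ hhb hne
    rw [← orbit_eq_iff.2 hhb, ← hφa]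
    exact mem_orbit_smul (⟨φ, hφ⟩ : G) a
  have hpairs : (orbit G b).offDiag ⊆ orbit G (a, b) := offDiag_orbit_subset hstab
  have hlim : limitSet G ⊆ orbit G b := hf.limitSet_subset_orbit hX hclosed hfG ha hpairs
  refine htrans fun p hp q hq => ?_
  obtain ⟨u, hu⟩ : q ∈ orbit G p := by
    rw [orbit_eq_iff.2 (hpairs (offDiag_mono hlim hp))]
    exact hpairs (offDiag_mono hlim hq)
  exact ⟨u, u.2, hu⟩

theorem mainTheorem10 {X : Type*} [MetricSpace X] [ProperSpace X] (hX : RankOne.IsCAT0 X)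
    (G : Subgroup (X ≃ᵢ X)) (hclosed : IsClosed (G : Set (X ≃ᵢ X)))
    (hG : RankOne.IsNonelementary G)
    (g : X ≃ᵢ X) (hgG : g ∈ G) (hg : RankOne.IsRankOne g)
    (a b : RankOne.Boundary X) (ha : a ∈ RankOne.limitSet G) (hb : b ∈ RankOne.limitSet G)
    (hab : a ≠ b) (hga : g • a = a) (hgb : g • b = b)
    (htrans : ¬ ∀ p ∈ (RankOne.limitSet G).offDiag, ∀ q ∈ (RankOne.limitSet G).offDiag,
      ∃ u ∈ G, u • p = q) :
    ∃ h : G, IsCompact (MulAction.stabilizer G (b, h • b) : Set G) := by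
  refine mainTheorem10_general hX.isBusemannConvex G hclosed g hgG hg b hgb ?_ htrans
  by_contra! hfix
  exact hG.2 ⟨b, hfix⟩
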